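/- Fix integers $n\ge 2$ and $v\ge 1$. For $\rho>0$ put $\mathcal B_v(\rho)=\{x\in\mathbb R^v:\ \sum_i x_i^2<\rho\}$, and for $\lambda\in(0,\infty)^v$ and $1\le k\le v$ let $$\alpha(\rho;\lambda)=\int_{\mathcal B_v(\rho)}\prod_{i=1}^v\frac{e^{-x_i^2/(2\lambda_i)}}{\sqrt{2\pi\lambda_i}}\,d^vx,\qquad \alpha_k(\rho;\lambda)=\int_{\mathcal B_v(\rho)}\frac{x_k^2}{\lambda_k}\prod_{i=1}^v\frac{e^{-x_i^2/(2\lambda_i)}}{\sqrt{2\pi\lambda_i}}\,d^vx,\qquad R_k=\frac{\alpha_k}{\alpha}.$$ Let $F_\nu$ be the cumulative distribution function of the $\chi^2$ law with $\nu$ degrees of freedom. For $\tilde\lambda>0$ and vectors $\lambda^{(1)},\lambda^{(2)},\ldots\in\mathbb R^v$ let $\lambda_k(\epsilon)=\tilde\lambda+\epsilon\lambda^{(1)}_k+\epsilon^2\lambda^{(2)}_k+\cdots$ (only the coefficients up to order $n$ matter below), let $R_k^{(j)}=\frac1{j!}\frac{d^j}{d\epsilon^j}R_k(\rho;\lambda(\epsilon))|_{\epsilon=0}$,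 and, given $\mu^{(n)}\in\mathbb R^v$, let $$\mathcal E_k^{(n)}=\sum_{j=0}^n\lambda_k^{(n-j)}R_k^{(j)}-\mu_k^{(n)}\qquad(\lambda^{(0)}_k=\tilde\lambda)$$ be the order-$n$ part of $\lambda_k(\epsilon)R_k(\rho;\lambda(\epsilon))-\mu_k(\epsilon)$. With all $\chi^2$ distribution functions evaluated at $\rho/\tilde\lambda$, let $$\mathcal J_{kj}=\frac12\Big[(1+2\delta_{kj})\frac{F_{v+4}}{F_v}-\frac{F_{v+2}^2}{F_v^2}\Big],\qquad \mathcal G^{(n)}_k=\sum_{j=1}^v\mathcal J_{kj}\lambda^{(n)}_j-\mathcal E^{(n)}_k ,$$ so that the equations $\mathcal E^{(n)}_k=0$ read $\mathcal J\lambda^{(n)}=\mathcal G^{(n)}$. A *structure of order $n$* is a product $$\mathcal O^{(n)}_{k;m}=\tilde\lambda^{a}\prod_{j\in b}\lambda^{(j)}_k\prod_{t\in T}\Big(\sum_{i=1}^v\prod_{j\in t}\lambda^{(j)}_i\Big),$$ where $m=(a,b,T)$, $a\ge0$ is an integer, $b$ is a finite multiset of elements of $\{1,\ldots,n-1\}$,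 $T$ is a finite multiset of nonempty finite multisets of elements of $\{1,\ldots,n-1\}$, $a+|b|+\sum_{t\in T}|t|=n$, and $\sum_{j\in b}j+\sum_{t\in T}\sum_{j\in t}j=n$. There are finitely many such $m$, and their set does not depend on $v$. Let $\mathcal K_n$ be the set of integer tuples $(k_1,\ldots,k_{n+1})$ with $n+1\ge k_1\ge\cdots\ge k_{n+1}\ge0$ and $K=\sum_jk_j\le n+1$. Real numbers $\gamma^{(n,m)}_{k_1\ldots k_{n+1}}$ are called *coefficients of $\mathcal G^{(n)}$ in dimension $v$* if $$\mathcal G^{(n)}_k=\mu^{(n)}_k+\tilde\lambda^{1-n}\sum_{(k_1,\ldots,k_{n+1})\in\mathcal K_n}\Big(\sum_m\gamma^{(n,m)}_{k_1\ldots k_{n+1}}\mathcal O^{(n)}_{k;m}\Big)\frac{F_{v+2k_1}\cdots F_{v+2k_{n+1}}}{F_v^{\,n+1}}$$ for all $1\le k\le v$, all $\rho,\tilde\lambda>0$ and all $\lambda^{(1)},\lambda^{(2)},\ldots,\mu^{(n)}\in\mathbb R^v$. **Proposition.** Let $n\ge2$. 1. There are real numbers $\gamma^{(n,m)}_{k_1\ldots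 k_{n+1}}$, not depending on $v$, that are coefficients of $\mathcal G^{(n)}$ in every dimension $v\ge1$. 2. Whenever real numbers $\gamma^{(n,m)}_{k_1\ldots k_{n+1}}$ are coefficients of $\mathcal G^{(n)}$ in some dimension $v\ge n+1$ (in particular, whenever they are so in every dimension), then, for every structure $m$ of order $n$, $$\sum_{(k_1,\ldots,k_{n+1})\in\mathcal K_n}\gamma^{(n,m)}_{k_1\ldots k_{n+1}}=0 .$$ -/

import Mathlib

open MeasureTheory ProbabilityTheory

namespace TruncatedSpectrum

noncomputable section

/-- Cumulative distribution function `F_ν` of the chi-squared law with `ν` degrees of freedom,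
i.e. of the Gamma law with shape `ν / 2` and rate `1 / 2`. -/
def chiSqCDF (ν : ℕ) (x : ℝ) : ℝ :=
  cdf (gammaMeasure ((ν : ℝ) / 2) (1 / 2)) x

/-- The centred one-dimensional Gaussian density with variance `η > 0`. -/
def gaussDensity (y η : ℝ) : ℝ :=
  (Real.sqrt (2 * Real.pi * η))⁻¹ * Real.exp (-(y ^ 2) / (2 * η))

/-- The Euclidean ball of square radius `ρ` in `ℝ^v`. -/
def sqBall (v : ℕ) (ρ : ℝ) : Set (Fin v → ℝ) :=
  {x | ∑ i, x i ^ 2 < ρ}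

/-- The Gaussian integral `α(ρ; l)`: the mass of the ball under `N(0, diag l)`. -/
def alpha {v : ℕ} (ρ : ℝ) (l : Fin v → ℝ) : ℝ :=
  ∫ x in sqBall v ρ, ∏ i, gaussDensity (x i) (l i)

/-- The Gaussian integral `α_k(ρ; l)`: the integral of `x_k² / l_k` over the ball. -/
def alphaK {v : ℕ} (ρ : ℝ) (l : Fin v → ℝ) (k : Fin v) : ℝ :=
  ∫ x in sqBall v ρ, (x k ^ 2 / l k) * ∏ i, gaussDensity (x i) (l i)

/-- The integral ratio `R_k = α_k / α`; the truncated spectrum is `μ_k = l_k R_k(ρ; l)`. -/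
def ratioR {v : ℕ} (ρ : ℝ) (l : Fin v → ℝ) (k : Fin v) : ℝ :=
  alphaK ρ l k / alpha ρ l

/-- The curve `ε ↦ λ(ε)` with Taylor coefficients `lam 0, …, lam n` at `ε = 0`. Coefficients of
order larger than `n` do not affect the equations of order at most `n`. -/
def path {v : ℕ} (n : ℕ) (lam : ℕ → Fin v → ℝ) (ε : ℝ) : Fin v → ℝ :=
  fun i => ∑ j ∈ Finset.range (n + 1), ε ^ j * lam j i

/-- `R_k^{(j)}`: the `j`-th Taylor coefficient at `ε = 0` of `R_k(ρ; λ(ε))`, for `j ≤ n`. -/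
def ratioCoef {v : ℕ} (n : ℕ) (ρ : ℝ) (lam : ℕ → Fin v → ℝ) (j : ℕ) (k : Fin v) : ℝ :=
  iteratedDeriv j (fun ε : ℝ => ratioR ρ (path n lam ε) k) 0 / (j.factorial : ℝ)

/-- `E_k^{(n)}`: left-hand side of the equation of order `n`, obtained by collecting the terms of
order `ε^n` in `λ_k(ε) R_k(ρ; λ(ε)) - μ_k(ε)`; `mu` is the `n`-th Taylor coefficient of `μ(ε)`. -/
def orderEq {v : ℕ} (n : ℕ) (ρ : ℝ) (lam : ℕ → Fin v → ℝ) (mu : Fin v → ℝ) (k : Fin v) : ℝ :=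
  ∑ j ∈ Finset.range (n + 1), lam (n - j) k * ratioCoef n ρ lam j k - mu k

/-- The matrix `J` at `λ̃ = lt`: the Jacobian of `l ↦ (l_k R_k(ρ; l))_k` at `(lt, …, lt)`. -/
def jac (v : ℕ) (ρ lt : ℝ) (k j : Fin v) : ℝ :=
  (1 / 2) *
    ((1 + 2 * (if k = j then 1 else 0)) * (chiSqCDF (v + 4) (ρ / lt) / chiSqCDF v (ρ / lt))
      - chiSqCDF (v + 2) (ρ / lt) ^ 2 / chiSqCDF v (ρ / lt) ^ 2)

/-- The source term `G_k^{(n)}`: the equations `E_k^{(n)} = 0` read `∑ j, J_kj λ_j^{(n)} = G_k^{(n)}`.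
Here `lam 0` is the constant vector `(lt, …, lt)`. -/
def source {v : ℕ} (n : ℕ) (ρ lt : ℝ) (lam : ℕ → Fin v → ℝ) (mu : Fin v → ℝ) (k : Fin v) : ℝ :=
  ∑ j, jac v ρ lt k j * lam n j - orderEq n ρ lam mu k

/-- The admissible index tuples `n + 1 ≥ k_1 ≥ k_2 ≥ … ≥ k_{n+1} ≥ 0` with sum `K ≤ n + 1`. -/
def admissible (n : ℕ) : Finset (Fin (n + 1) → ℕ) :=
  (Fintype.piFinset fun _ : Fin (n + 1) => Finset.range (n + 2)).filter
    fun κ => (∀ i j, i ≤ j → κ j ≤ κ i) ∧ ∑ j, κ j ≤ n + 1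

/-- The chi-squared ratio `F_{v+2k_1} ⋯ F_{v+2k_{n+1}} / F_v^{n+1}` at the point `x`. -/
def chiSqRatio (n v : ℕ) (κ : Fin (n + 1) → ℕ) (x : ℝ) : ℝ :=
  (∏ j, chiSqCDF (v + 2 * κ j) x) / chiSqCDF v x ^ (n + 1)

/-- A product of perturbative structures of order `n`,
`λ̃^a · ∏_{j ∈ b} λ_k^{(j)} · ∏_{t ∈ T} (∑_i ∏_{j ∈ t} λ_i^{(j)})`,
encoded by the exponent `a` of `λ̃`, the multiset `b` of the perturbative orders of the factors in
the direction `k`, and the multiset `T` of the aggregates `ζ_t`, each given by the nonempty multiset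
`t` of its perturbative orders. All orders lie in `{1, …, n - 1}`, and both the physical and the
perturbative dimension are equal to `n`. -/
structure PertStructure (n : ℕ) where
  a : ℕ
  b : Multiset ℕ
  T : Multiset (Multiset ℕ)
  b_range : ∀ j ∈ b, 1 ≤ j ∧ j < n
  T_ne : ∀ t ∈ T, t ≠ 0
  T_range : ∀ t ∈ T, ∀ j ∈ t, 1 ≤ j ∧ j < n
  physDim : a + b.card + (T.map Multiset.card).sum = n
  pertDim : b.sum + (T.map Multiset.sum).sum = n

theorem PertStructure.ext_of {n : ℕ} {m m' : PertStructure n} (hb : m.b = m'.b)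
    (hT : m.T = m'.T) : m = m' := by
  have ha : m.a = m'.a := by
    have h1 := m.physDim
    have h2 := m'.physDim
    rw [hb, hT] at h1
    omega
  cases m
  cases m'
  simp only at ha hb hT
  subst ha hb hT
  rfl

instance PertStructure.instFinite (n : ℕ) : Finite (PertStructure n) := by
  set M : Multiset ℕ := n • Multiset.range n with hM
  have hle : ∀ s : Multiset ℕ, s.card ≤ n → (∀ j ∈ s, j < n) → s ≤ M := by
    intro s hs hj
    rw [Multiset.le_iff_count]
    intro i
    by_cases hi : i ∈ s
    · have : Multiset.count i (Multiset.range n) = 1 :=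
        Multiset.count_eq_one_of_mem (Multiset.nodup_range n) (Multiset.mem_range.2 (hj i hi))
      rw [hM, Multiset.count_nsmul, this, mul_one]
      exact (Multiset.count_le_card i s).trans hs
    · rw [Multiset.count_eq_zero_of_notMem hi]
      exact Nat.zero_le _
  set N : Multiset (Multiset ℕ) := n • M.powerset.dedup with hN
  have hcard : ∀ S : Multiset (Multiset ℕ), (∀ t ∈ S, t ≠ 0) →
      S.card ≤ (S.map Multiset.card).sum := by
    intro S
    induction S using Multiset.induction_on with
    | empty => intro _; simp
    | cons t S ih =>
      intro h
      have h1 : 0 < t.card := Multiset.card_pos.2 (h t (Multiset.mem_cons_self t S))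
      have h2 := ih fun s hs => h s (Multiset.mem_cons_of_mem hs)
      simp only [Multiset.card_cons, Multiset.map_cons, Multiset.sum_cons]
      omega
  have hmem : ∀ m : PertStructure n, m.b ≤ M ∧ m.T ≤ N := by
    intro m
    have hp := m.physDim
    refine ⟨hle _ (by omega) fun j hj => (m.b_range j hj).2, ?_⟩
    rw [Multiset.le_iff_count]
    intro t
    by_cases ht : t ∈ m.T
    · have hc : t.card ≤ (m.T.map Multiset.card).sum :=
        Multiset.single_le_sum (fun _ _ => Nat.zero_le _) _ (Multiset.mem_map_of_mem _ ht)
      have htM : t ∈ M.powerset.dedup := by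
        rw [Multiset.mem_dedup, Multiset.mem_powerset]
        exact hle t (by omega) fun j hj => (m.T_range t ht j hj).2
      rw [hN, Multiset.count_nsmul,
        Multiset.count_eq_one_of_mem (Multiset.nodup_dedup _) htM, mul_one]
      have h1 := Multiset.count_le_card t m.T
      have h2 := hcard m.T m.T_ne
      omega
    · rw [Multiset.count_eq_zero_of_notMem ht]
      exact Nat.zero_le _
  have : Finite (Set.Iic M) := Set.finite_Iic M
  have : Finite (Set.Iic N) := Set.finite_Iic N
  refine Finite.of_injective
    (fun m : PertStructure n =>
      ((⟨m.b, (hmem m).1⟩, ⟨m.T, (hmem m).2⟩) : Set.Iic M × Set.Iic N)) ?_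
  intro m m' h
  simp only [Prod.mk.injEq] at h
  exact PertStructure.ext_of (Subtype.ext_iff.1 h.1) (Subtype.ext_iff.1 h.2)

instance PertStructure.instFintype (n : ℕ) : Fintype (PertStructure n) := Fintype.ofFinite _

/-- The value `O^{(n)}_{k;m}` of the structure `m` in the direction `k`. -/
def PertStructure.val {n v : ℕ} (m : PertStructure n) (lt : ℝ) (lam : ℕ → Fin v → ℝ)
    (k : Fin v) : ℝ :=
  lt ^ m.a * (m.b.map fun j => lam j k).prod *
    (m.T.map fun t => ∑ i, (t.map fun j => lam j i).prod).prod

/-- The coefficient `c^{(n)}_{k;κ} = ∑_m γ^{(n,m)}_κ O^{(n)}_{k;m}`. -/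
def cCoef {n v : ℕ} (γ : (Fin (n + 1) → ℕ) → PertStructure n → ℝ) (lt : ℝ)
    (lam : ℕ → Fin v → ℝ) (k : Fin v) (κ : Fin (n + 1) → ℕ) : ℝ :=
  ∑ m, γ κ m * m.val lt lam k

/-- The numbers `γ` are coefficients of the source term of order `n` in dimension `v`:
`G_k^{(n)} = μ_k^{(n)} + λ̃^{1-n} ∑_κ c^{(n)}_{k;κ} F_{v+2k_1} ⋯ F_{v+2k_{n+1}} / F_v^{n+1}`
identically in the square radius, in `λ̃`, and in the Taylor coefficients of `λ` and `μ`. -/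
def IsGamma (n v : ℕ) (γ : (Fin (n + 1) → ℕ) → PertStructure n → ℝ) : Prop :=
  ∀ (ρ lt : ℝ), 0 < ρ → 0 < lt → ∀ (lam : ℕ → Fin v → ℝ), (∀ i, lam 0 i = lt) →
    ∀ (mu : Fin v → ℝ) (k : Fin v),
      source n ρ lt lam mu k =
        mu k + lt ^ (1 - (n : ℤ)) *
          ∑ κ ∈ admissible n, cCoef γ lt lam k κ * chiSqRatio n v κ (ρ / lt)

end

end TruncatedSpectrum

namespace TruncatedSpectrum

noncomputable section

/-! Let `psi r` be the Gaussian density times the normalised weight `(y²/η)^r`. Differentiating in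
the variance `η` gives a multiple of `psi (r + 1) - psi r`, so the ball integrals `Phi ρ l m` of
products of such densities form a closed differential system along the path `λ(ε)`. When all
variances are equal, `Phi` depends only on `∑ m i` and equals `F_{v + 2∑m}`, because the sum of the
squares has a gamma law (`Phi_const`).

The same system has an explicit formal solution `PhiP` over `ℝ[X]`, in which `X^k` stands for
`F_{v+2k}`: with `δ_i` the relative perturbation, it is `X^{∑m} ∏ (1 + δ_i(1 - X))^{-1/2 - m_i}`.
Comparing recursions and initial values shows that the Taylor series of `Phi` is the image of `PhiP`
under the linear map `ell` (`taylorSeries_Phi`). This covers `α` and `α_k`.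

For existence, the coefficient of order `d` of each series is a combination of structures of order
`d` with constant polynomials, or products of ratios `F_{v+2j}/F_v`, of controlled size. At order
`n` there is one exception, a term linear in `λ^{(n)}`, which `Tracked` records. In `λ_k R_k` this
term is exactly `J λ^{(n)}`, so it drops out of the source (`relSource_mem`). All spans consist of
functions on `Datum`, where the dimension is part of the point, so the resulting scalars are
independent of `v`.

For the sum rule, let `ρ → ∞`. Every ratio tends to `1`, `J` tends to the identity and `R_k` to `1`
as a power series in `ε`, so the source without `μ` tends to `0` (`tendsto_source`). The
representation then becomes `∑_m (∑_κ γ) O_m = 0` for all perturbations, and the structures are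
linearly independent when `v ≥ n + 1` (`linearIndependent_val`). -/

/-! ### Weighted Gaussian densities and their dependence on the variance -/

open Finset in
/-- The density `y ^ (2r) / (η ^ r (2r - 1)!!)` with respect to the centred Gaussian of
variance `η`. -/
def psi (r : ℕ) (y η : ℝ) : ℝ :=
  (∏ i ∈ range r, (2 * (i : ℝ) + 1))⁻¹ * (y ^ 2 / η) ^ r * gaussDensity y η

lemma psi_zero (y η : ℝ) : psi 0 y η = gaussDensity y η := by
  simp [psi]

lemma psi_succ (r : ℕ) (y η : ℝ) :
    psi (r + 1) y η = psi r y η * (y ^ 2 / η / (2 * r + 1)) := by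
  rw [psi, psi, Finset.prod_range_succ, mul_inv, pow_succ, div_eq_mul_inv _ (2 * (r : ℝ) + 1)]
  ring

lemma gaussDensity_nonneg (y η : ℝ) : 0 ≤ gaussDensity y η := by
  unfold gaussDensity; positivity

lemma psi_nonneg (r : ℕ) (y : ℝ) {η : ℝ} (hη : 0 < η) : 0 ≤ psi r y η := by
  have := gaussDensity_nonneg y η
  unfold psi; positivity

lemma continuousOn_psi (r : ℕ) : ContinuousOn (fun p : ℝ × ℝ => psi r p.1 p.2) {p | 0 < p.2} := by
  have h2 : ContinuousOn (fun p : ℝ × ℝ => p.2) {p | 0 < p.2} := continuousOn_snd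
  have h1 : ContinuousOn (fun p : ℝ × ℝ => p.1) {p | 0 < p.2} := continuousOn_fst
  have h0 : ∀ p ∈ {p : ℝ × ℝ | 0 < p.2}, p.2 ≠ 0 := fun p hp => ne_of_gt hp
  unfold psi gaussDensity
  refine ((continuousOn_const.mul (((h1.pow 2).div h2 h0).pow r))).mul (.mul ?_ ?_)
  · refine (Real.continuous_sqrt.comp_continuousOn (continuousOn_const.mul h2)).inv₀ ?_
    intro p (hp : 0 < p.2)
    have : 0 < 2 * Real.pi * p.2 := by positivity
    exact (Real.sqrt_pos.2 this).ne'
  · refine Real.continuous_exp.comp_continuousOn ?_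
    refine (h1.pow 2).neg.div (continuousOn_const.mul h2) ?_
    intro p (hp : 0 < p.2)
    positivity

lemma continuous_psi (r : ℕ) (η : ℝ) : Continuous fun y => psi r y η := by
  unfold psi gaussDensity
  fun_prop

lemma hasDerivAt_gaussDensity (y : ℝ) {η : ℝ} (hη : 0 < η) :
    HasDerivAt (gaussDensity y) (gaussDensity y η * (y ^ 2 / (2 * η ^ 2) - 1 / (2 * η))) η := by
  have hp : 0 < 2 * Real.pi * η := by positivity
  have h1 : HasDerivAt (fun η : ℝ => 2 * Real.pi * η) (2 * Real.pi) η := by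
    simpa using (hasDerivAt_id η).const_mul (2 * Real.pi)
  have h2 := (h1.sqrt hp.ne').inv (Real.sqrt_pos.2 hp).ne'
  have h3 : HasDerivAt (fun η : ℝ => -(y ^ 2) / (2 * η)) (y ^ 2 / (2 * η ^ 2)) η := by
    have := (((hasDerivAt_id η).const_mul (2 : ℝ)).inv (by positivity)).const_mul (-(y ^ 2))
    convert! this using 1
    simp; field_simp
  have h4 := h2.mul h3.exp
  have hs : Real.sqrt (2 * Real.pi * η) ^ 2 = 2 * Real.pi * η := Real.sq_sqrt hp.le
  refine h4.congr_deriv ?_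
  have hs0 := (Real.sqrt_pos.2 hp).ne'
  simp only [gaussDensity, Pi.inv_apply]
  have : -(2 * Real.pi / (2 * Real.sqrt (2 * Real.pi * η))) / Real.sqrt (2 * Real.pi * η) ^ 2
      = - (Real.sqrt (2 * Real.pi * η))⁻¹ * (1 / (2 * η)) := by
    rw [hs]; field_simp
  rw [this]
  ring

/-- The normalisation by odd numbers makes the two coefficients opposite: `y²/η` times `psi r` is
`(2r + 1)` times `psi (r + 1)`. Hence the family is closed under differentiation. -/
lemma hasDerivAt_psi (r : ℕ) (y : ℝ) {η : ℝ} (hη : 0 < η) :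
    HasDerivAt (psi r y) ((r + 1 / 2) / η * (psi (r + 1) y η - psi r y η)) η := by
  have key : ∀ r : ℕ, HasDerivAt (psi r y)
      (psi r y η * (y ^ 2 / (2 * η ^ 2) - (r + 1 / 2) / η)) η := by
    intro r
    induction r with
    | zero =>
      have h := hasDerivAt_gaussDensity y hη
      have e : psi 0 y = gaussDensity y := funext fun _ => psi_zero _ _
      rw [e]
      refine h.congr_deriv ?_
      push_cast
      field_simp
      ring
    | succ r ih =>
      have h3 : HasDerivAt (fun η : ℝ => y ^ 2 / η / (2 * r + 1))
          (-(y ^ 2) / η ^ 2 / (2 * r + 1)) η := by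
        have := ((hasDerivAt_inv hη.ne').const_mul (y ^ 2)).div_const (2 * (r : ℝ) + 1)
        convert! this using 1
        field_simp
      have e : psi (r + 1) y = fun η => psi r y η * (y ^ 2 / η / (2 * r + 1)) :=
        funext fun _ => psi_succ _ _ _
      rw [e]
      refine (ih.mul h3).congr_deriv ?_
      push_cast
      field_simp
      ring
  refine (key r).congr_deriv ?_
  rw [psi_succ]
  have : (2 * (r : ℝ) + 1) ≠ 0 := by positivity
  field_simp

/-! ### Ball integrals and differentiation under the integral sign -/

/-- The mass of the ball under the product of the densities `psi (m i)`. -/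
def Phi {v : ℕ} (ρ : ℝ) (l : Fin v → ℝ) (m : Fin v → ℕ) : ℝ :=
  ∫ x in sqBall v ρ, ∏ i, psi (m i) (x i) (l i)

lemma alpha_eq_Phi {v : ℕ} (ρ : ℝ) (l : Fin v → ℝ) : alpha ρ l = Phi ρ l 0 := by
  simp [alpha, Phi, psi_zero]

lemma alphaK_eq_Phi {v : ℕ} (ρ : ℝ) (l : Fin v → ℝ) (k : Fin v) :
    alphaK ρ l k = Phi ρ l (Pi.single k 1) := by
  unfold alphaK Phi
  congr 1
  ext x
  rw [← Finset.mul_prod_erase _ _ (Finset.mem_univ k),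
    ← Finset.mul_prod_erase _ (fun i => psi _ _ _) (Finset.mem_univ k)]
  have : ∀ i ∈ Finset.univ.erase k, psi ((Pi.single k 1 : Fin v → ℕ) i) (x i) (l i)
      = gaussDensity (x i) (l i) := by
    intro i hi
    rw [Pi.single_eq_of_ne (Finset.ne_of_mem_erase hi), psi_zero]
  rw [Finset.prod_congr rfl this, Pi.single_eq_same, psi_succ, psi_zero]
  simp
  ring

lemma measurableSet_sqBall (v : ℕ) (ρ : ℝ) : MeasurableSet (sqBall v ρ) :=
  measurableSet_lt (by fun_prop) measurable_const

/-- A compact box containing the ball. -/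
def box (v : ℕ) (ρ : ℝ) : Set (Fin v → ℝ) :=
  Set.univ.pi fun _ => Set.Icc (-Real.sqrt ρ) (Real.sqrt ρ)

lemma isCompact_box (v : ℕ) (ρ : ℝ) : IsCompact (box v ρ) :=
  isCompact_univ_pi fun _ => isCompact_Icc

lemma sqBall_subset_box (v : ℕ) (ρ : ℝ) : sqBall v ρ ⊆ box v ρ := by
  intro x (hx : ∑ i, x i ^ 2 < ρ) i _
  have : x i ^ 2 ≤ ρ :=
    (Finset.single_le_sum (f := fun i => x i ^ 2) (fun _ _ => sq_nonneg _)
      (Finset.mem_univ i)).trans hx.le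
  exact abs_le.1 (Real.abs_le_sqrt this)

lemma integrableOn_sqBall {v : ℕ} (ρ : ℝ) {f : (Fin v → ℝ) → ℝ} (hf : Continuous f) :
    IntegrableOn f (sqBall v ρ) :=
  (hf.continuousOn.integrableOn_compact (isCompact_box v ρ)).mono_set (sqBall_subset_box v ρ)

lemma continuous_prod_psi {v : ℕ} (l : Fin v → ℝ) (m : Fin v → ℕ) :
    Continuous fun x : Fin v → ℝ => ∏ i, psi (m i) (x i) (l i) :=
  continuous_finsetProd _ fun i _ => (continuous_psi (m i) (l i)).comp (continuous_apply i)

lemma hasDerivAt_prod_psi {v : ℕ} {L : ℝ → Fin v → ℝ} {L' : Fin v → ℝ} {ε : ℝ}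
    (hL : ∀ i, HasDerivAt (fun ε => L ε i) (L' i) ε) (hpos : ∀ i, 0 < L ε i)
    (m : Fin v → ℕ) (x : Fin v → ℝ) :
    HasDerivAt (fun ε => ∏ i, psi (m i) (x i) (L ε i))
      (∑ i, L' i / L ε i * (m i + 1 / 2) *
        (∏ j, psi ((m + Pi.single i 1 : Fin v → ℕ) j) (x j) (L ε j) - ∏ j, psi (m j) (x j) (L ε j))) ε := by
  have h : ∀ i, HasDerivAt (fun ε => psi (m i) (x i) (L ε i))
      ((m i + 1 / 2) / L ε i * (psi (m i + 1) (x i) (L ε i) - psi (m i) (x i) (L ε i)) * L' i)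
      ε := fun i => (hasDerivAt_psi (m i) (x i) (hpos i)).comp ε (h := fun ε => L ε i) (hL i)
  refine (HasDerivAt.fun_finsetProd (u := Finset.univ) (fun i _ => h i)).congr_deriv ?_
  refine Finset.sum_congr rfl fun i _ => ?_
  rw [← Finset.mul_prod_erase _ _ (Finset.mem_univ i),
    ← Finset.mul_prod_erase _ (fun j => psi (m j) _ _) (Finset.mem_univ i)]
  have : ∀ j ∈ Finset.univ.erase i, psi ((m + Pi.single i 1 : Fin v → ℕ) j) (x j) (L ε j)
      = psi (m j) (x j) (L ε j) := by
    intro j hj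
    simp [Pi.single_eq_of_ne (Finset.ne_of_mem_erase hj)]
  rw [Finset.prod_congr rfl this]
  simp only [Pi.add_apply, Pi.single_eq_same, smul_eq_mul]
  ring

lemma hasDerivAt_Phi {v : ℕ} (ρ : ℝ) {L L' : ℝ → Fin v → ℝ}
    (hL : ∀ ε i, HasDerivAt (fun ε => L ε i) (L' ε i) ε)
    (hL' : ∀ i, Continuous fun ε => L' ε i) {ε₀ : ℝ} (hpos : ∀ i, 0 < L ε₀ i)
    (m : Fin v → ℕ) :
    HasDerivAt (fun ε => Phi ρ (L ε) m)
      (∑ i, L' ε₀ i / L ε₀ i * (m i + 1 / 2) *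
        (Phi ρ (L ε₀) (m + Pi.single i 1) - Phi ρ (L ε₀) m)) ε₀ := by
  have hc : ∀ i, Continuous fun ε => L ε i := fun i =>
    continuous_iff_continuousAt.2 fun ε => (hL ε i).continuousAt
  have hopen : IsOpen {ε | ∀ i, 0 < L ε i} := by
    simp only [Set.ofPred_forall]
    exact isOpen_iInter_of_finite fun i => isOpen_lt continuous_const (hc i)
  obtain ⟨δ, hδ, hball⟩ := Metric.nhds_basis_closedBall.mem_iff.1 (hopen.mem_nhds hpos)
  let F' : ℝ → (Fin v → ℝ) → ℝ := fun ε x => ∑ i, L' ε i / L ε i * (m i + 1 / 2) *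
        (∏ j, psi ((m + Pi.single i 1 : Fin v → ℕ) j) (x j) (L ε j) - ∏ j, psi (m j) (x j) (L ε j))
  have hpsi : ∀ (r : ℕ) (j : Fin v), ContinuousOn
      (fun p : ℝ × (Fin v → ℝ) => psi r (p.2 j) (L p.1 j))
      (Metric.closedBall ε₀ δ ×ˢ box v ρ) := by
    intro r j
    refine (continuousOn_psi r).comp (f := fun p : ℝ × (Fin v → ℝ) => (p.2 j, L p.1 j))
      (Continuous.continuousOn ?_) fun p hp => hball hp.1 j
    exact ((continuous_apply j).comp continuous_snd).prodMk ((hc j).comp continuous_fst)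
  have hF'c : ContinuousOn (fun p : ℝ × (Fin v → ℝ) => F' p.1 p.2)
      (Metric.closedBall ε₀ δ ×ˢ box v ρ) := by
    refine continuousOn_finsetSum _ fun i _ => ?_
    refine ContinuousOn.mul (ContinuousOn.mul (ContinuousOn.div ?_ ?_ ?_) continuousOn_const)
      (ContinuousOn.sub ?_ ?_)
    · exact ((hL' i).comp continuous_fst).continuousOn
    · exact ((hc i).comp continuous_fst).continuousOn
    · exact fun p hp => (hball hp.1 i).ne'
    · exact continuousOn_finsetProd _ fun j _ => hpsi _ j
    · exact continuousOn_finsetProd _ fun j _ => hpsi _ j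
  -- The derivative is jointly continuous on a compact set on which all variances are positive, so a
  -- constant dominates it.
  obtain ⟨C, hC⟩ := ((isCompact_closedBall ε₀ δ).prod
    (isCompact_box v ρ)).exists_bound_of_continuousOn hF'c
  have hint : ∀ m : Fin v → ℕ, IntegrableOn
      (fun x : Fin v → ℝ => ∏ j, psi (m j) (x j) (L ε₀ j)) (sqBall v ρ) := fun m =>
    integrableOn_sqBall ρ (continuous_prod_psi (L ε₀) m)
  have hfin : volume (sqBall v ρ) ≠ ⊤ :=
    ((measure_mono (sqBall_subset_box v ρ)).trans_lt (isCompact_box v ρ).measure_lt_top).ne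
  have main := hasDerivAt_integral_of_dominated_loc_of_deriv_le
    (μ := volume.restrict (sqBall v ρ)) (s := Metric.closedBall ε₀ δ) (bound := fun _ => C)
    (F := fun ε x => ∏ i, psi (m i) (x i) (L ε i)) (F' := F')
    (Metric.closedBall_mem_nhds ε₀ hδ)
    (Filter.Eventually.of_forall fun ε => (continuous_prod_psi (L ε) m).aestronglyMeasurable)
    (hint m) ?_ ?_ ?_ ?_
  · have h2 := main.2
    have e : ∫ x in sqBall v ρ, F' ε₀ x = ∑ i, L' ε₀ i / L ε₀ i * (m i + 1 / 2) *
        (Phi ρ (L ε₀) (m + Pi.single i 1) - Phi ρ (L ε₀) m) := by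
      have hi : ∀ i, IntegrableOn (fun x : Fin v → ℝ => L' ε₀ i / L ε₀ i * (m i + 1 / 2) *
          (∏ j, psi ((m + Pi.single i 1 : Fin v → ℕ) j) (x j) (L ε₀ j)
            - ∏ j, psi (m j) (x j) (L ε₀ j))) (sqBall v ρ) :=
        fun i => ((hint _).sub (hint _)).const_mul _
      simp only [F']
      rw [integral_finsetSum _ fun i _ => hi i]
      refine Finset.sum_congr rfl fun i _ => ?_
      rw [integral_const_mul, integral_sub (hint _) (hint _)]
      rfl
    rw [e] at h2
    exact h2
  · refine Continuous.aestronglyMeasurable ?_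
    exact continuous_finsetSum _ fun i _ => continuous_const.mul
      ((continuous_prod_psi _ _).sub (continuous_prod_psi _ _))
  · refine (ae_restrict_iff' (measurableSet_sqBall v ρ)).2 (Filter.Eventually.of_forall ?_)
    exact fun x hx ε hε => hC (ε, x) ⟨hε, sqBall_subset_box v ρ hx⟩
  · exact integrableOn_const hfin
  · exact Filter.Eventually.of_forall fun x ε hε =>
      hasDerivAt_prod_psi (hL ε) (hball hε) m x

/-- The derivative of one `Phi` is a combination of others with smooth coefficients; induction on
the order with `m` free then gives smoothness of every finite order. -/
lemma contDiffOn_Phi {v : ℕ} (ρ : ℝ) {L L' : ℝ → Fin v → ℝ}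
    (hL : ∀ ε i, HasDerivAt (fun ε => L ε i) (L' ε i) ε)
    (hs : ∀ i, ContDiff ℝ ⊤ fun ε => L ε i) (hs' : ∀ i, ContDiff ℝ ⊤ fun ε => L' ε i)
    (N : ℕ) (m : Fin v → ℕ) :
    ContDiffOn ℝ N (fun ε => Phi ρ (L ε) m) {ε | ∀ i, 0 < L ε i} := by
  have hopen : IsOpen {ε | ∀ i, 0 < L ε i} := by
    simp only [Set.ofPred_forall]
    exact isOpen_iInter_of_finite fun i => isOpen_lt continuous_const (hs i).continuous
  have hd := fun m ε (hε : ∀ i, 0 < L ε i) =>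
    hasDerivAt_Phi ρ hL (fun i => (hs' i).continuous) hε m
  induction N generalizing m with
  | zero =>
    exact contDiffOn_zero.2 fun ε hε => (hd m ε hε).continuousAt.continuousWithinAt
  | succ N ih =>
    rw [Nat.cast_succ, contDiffOn_succ_iff_deriv_of_isOpen hopen]
    refine ⟨fun ε hε => (hd m ε hε).differentiableAt.differentiableWithinAt, by simp, ?_⟩
    refine ContDiffOn.congr (f := fun ε => ∑ i, L' ε i / L ε i * (m i + 1 / 2) *
        (Phi ρ (L ε) (m + Pi.single i 1) - Phi ρ (L ε) m)) ?_ fun ε hε => (hd m ε hε).deriv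
    refine ContDiffOn.sum fun i _ => ?_
    refine ContDiffOn.mul (ContDiffOn.mul (ContDiffOn.div ?_ ?_ ?_) contDiffOn_const)
      ((ih _).sub (ih _))
    · exact ((hs' i).of_le le_top).contDiffOn
    · exact ((hs i).of_le le_top).contDiffOn
    · exact fun ε hε => (hε i).ne'

/-! ### Gamma laws and the value of the ball integrals on the diagonal -/

lemma integrable_exp_mul_gammaMeasure {a t : ℝ} (ha : 0 < a) (ht : t < 1 / 2) :
    Integrable (fun x : ℝ => Real.exp (t * x)) (gammaMeasure a (1 / 2)) ∧
      ∫ x, Real.exp (t * x) ∂(gammaMeasure a (1 / 2)) = (1 - 2 * t)⁻¹ ^ a := by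
  have hr : 0 < 1 / 2 - t := by linarith
  have e : ∫ x, Real.exp (t * x) ∂(gammaMeasure a (1 / 2)) = (1 - 2 * t)⁻¹ ^ a := by
    have h1 : gammaMeasure a (1 / 2) =
        volume.withDensity fun x => ENNReal.ofReal (gammaPDFReal a (1 / 2) x) := rfl
    rw [h1, integral_withDensity_eq_integral_toReal_smul (by fun_prop) (by simp)]
    have h2 : ∀ x : ℝ, (ENNReal.ofReal (gammaPDFReal a (1 / 2) x)).toReal • Real.exp (t * x)
        = (Set.Ici (0 : ℝ)).indicator (fun x => (1 / 2) ^ a / Real.Gamma a *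
          (x ^ (a - 1) * Real.exp (-((1 / 2 - t) * x)))) x := by
      intro x
      rw [ENNReal.toReal_ofReal (gammaPDFReal_nonneg ha (by norm_num) x), gammaPDFReal,
        Set.indicator_apply]
      simp only [Set.mem_Ici, smul_eq_mul, ite_mul, zero_mul]
      refine if_congr Iff.rfl ?_ rfl
      rw [mul_assoc, mul_assoc, ← Real.exp_add]
      ring_nf
    simp_rw [h2]
    rw [integral_indicator measurableSet_Ici, integral_Ici_eq_integral_Ioi, integral_const_mul,
      Real.integral_rpow_mul_exp_neg_mul_Ioi ha hr]
    have hG := (Real.Gamma_pos_of_pos ha).ne'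
    rw [div_mul_eq_mul_div, mul_div_assoc, mul_div_assoc, div_self hG, mul_one,
      ← Real.mul_rpow (by norm_num) (by positivity)]
    congr 1
    have : 1 - 2 * t ≠ 0 := by linarith
    have := hr.ne'
    field_simp
  refine ⟨?_, e⟩
  -- The value computed above is positive, whereas a non-integrable function would have integral
  -- `0`.
  by_contra h
  rw [integral_undef h] at e
  have : 0 < (1 - 2 * t)⁻¹ ^ a := Real.rpow_pos_of_pos (by rw [inv_pos]; linarith) _
  linarith

/-- The real moment generating functions `(1 - 2s)^{-a}` are multiplicative in `a`. Both sides
extend analytically to the half-plane `re z < 1/2`, so the identity theorem carries the relation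
from real points near `0` to the imaginary axis. -/
lemma charFun_gammaMeasure_add {a b : ℝ} (ha : 0 < a) (hb : 0 < b) (t : ℝ) :
    charFun (gammaMeasure a (1 / 2)) t * charFun (gammaMeasure b (1 / 2)) t
      = charFun (gammaMeasure (a + b) (1 / 2)) t := by
  have hS : ∀ {a : ℝ}, 0 < a →
      Set.Iio (1 / 2 : ℝ) ⊆ interior (integrableExpSet id (gammaMeasure a (1 / 2))) := by
    intro a ha
    exact interior_maximal (fun t ht => (integrable_exp_mul_gammaMeasure ha ht).1) isOpen_Iio
  have hA : ∀ {a : ℝ}, 0 < a → AnalyticOnNhd ℂ (complexMGF id (gammaMeasure a (1 / 2)))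
      {z | z.re ∈ Set.Iio (1 / 2 : ℝ)} := fun ha =>
    analyticOnNhd_complexMGF.mono fun z hz => hS ha hz
  have hR : ∀ {a : ℝ}, 0 < a → ∀ s : ℝ, s < 1 / 2 →
      complexMGF id (gammaMeasure a (1 / 2)) s = (((1 - 2 * s)⁻¹ ^ a : ℝ) : ℂ) := by
    intro a ha s hs
    rw [complexMGF_ofReal, mgf]
    simp only [id, (integrable_exp_mul_gammaMeasure ha hs).2]
  have key := AnalyticOnNhd.eqOn_of_preconnected_of_frequently_eq
    ((hA ha).mul (hA hb)) (hA (add_pos ha hb))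
    (((convex_Iio (1 / 2 : ℝ)).linear_preimage Complex.reLm).isPreconnected)
    (z₀ := ((0 : ℝ) : ℂ)) (by simp) ?_
  · have := key (show (t * Complex.I : ℂ) ∈ _ by simp)
    simpa only [Pi.mul_apply, complexMGF_id_mul_I] using this
  · have h_real : ∃ᶠ (x : ℝ) in nhdsWithin 0 {0}ᶜ,
        (complexMGF id (gammaMeasure a (1 / 2)) * complexMGF id (gammaMeasure b (1 / 2))) x
          = complexMGF id (gammaMeasure (a + b) (1 / 2)) x := by
      refine Filter.Eventually.frequently ?_
      have : ∀ᶠ x : ℝ in nhdsWithin 0 {0}ᶜ, x < 1 / 2 :=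
        nhdsWithin_le_nhds (Iio_mem_nhds (by norm_num))
      filter_upwards [this] with x hx
      rw [Pi.mul_apply, hR ha x hx, hR hb x hx, hR (add_pos ha hb) x hx, ← Complex.ofReal_mul,
        Real.rpow_add (by rw [inv_pos]; linarith)]
    rw [Filter.frequently_iff_seq_forall] at h_real ⊢
    obtain ⟨xs, hx_tendsto, hx_eq⟩ := h_real
    refine ⟨fun n ↦ xs n, ?_, fun n ↦ hx_eq n⟩
    rw [tendsto_nhdsWithin_iff] at hx_tendsto ⊢
    exact ⟨(Complex.continuous_ofReal.tendsto 0).comp hx_tendsto.1, by simpa using hx_tendsto.2⟩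

lemma prod_charFun_gammaMeasure {ι : Type*} {s : Finset ι} (hs : s.Nonempty) (a : ι → ℝ)
    (ha : ∀ i, 0 < a i) (t : ℝ) :
    ∏ i ∈ s, charFun (gammaMeasure (a i) (1 / 2)) t
      = charFun (gammaMeasure (∑ i ∈ s, a i) (1 / 2)) t := by
  induction hs using Finset.Nonempty.cons_induction with
  | singleton i => simp
  | cons i s hi hs ih =>
    rw [Finset.prod_cons, Finset.sum_cons, ih,
      charFun_gammaMeasure_add (ha i) (Finset.sum_pos (fun j _ => ha j) hs)]

/-- The complex integral of an even function is twice its integral over the positive half-line. -/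
lemma integral_eq_two_mul_of_even {f : ℝ → ℂ} (hf : Integrable f) (he : ∀ x, f (-x) = f x) :
    ∫ x, f x = 2 * ∫ x in Set.Ioi (0 : ℝ), f x := by
  rw [← intervalIntegral.integral_Iic_add_Ioi (b := (0 : ℝ)) hf.integrableOn hf.integrableOn]
  have : ∫ x in Set.Iic (0 : ℝ), f x = ∫ x in Set.Ioi (0 : ℝ), f x := by
    have := integral_comp_neg_Ioi 0 f
    simp only [neg_zero, he] at this
    exact this.symm
  rw [this, two_mul]

lemma Gamma_nat_add_half' (r : ℕ) :
    Real.Gamma (r + 1 / 2) =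
      (∏ i ∈ Finset.range r, (2 * (i : ℝ) + 1)) * Real.sqrt Real.pi / 2 ^ r := by
  induction r with
  | zero => simpa using Real.Gamma_one_half_eq
  | succ r ih =>
    have : ((r + 1 : ℕ) : ℝ) + 1 / 2 = (r + 1 / 2 : ℝ) + 1 := by push_cast; ring
    rw [this, Real.Gamma_add_one (by positivity), ih, Finset.prod_range_succ, pow_succ]
    field_simp

/-- The square substitution turns the density `psi r` into a Gamma density. -/
lemma two_mul_psi_eq (r : ℕ) {x η : ℝ} (hx : 0 < x) (hη : 0 < η) :
    2 * psi r x η = (2 * x) * (η⁻¹ * gammaPDFReal (r + 1 / 2) (1 / 2) (η⁻¹ * x ^ 2)) := by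
  have hy : 0 < η⁻¹ * x ^ 2 := by positivity
  rw [gammaPDFReal, if_pos hy.le, Gamma_nat_add_half', psi, gaussDensity]
  have h1 : (η⁻¹ * x ^ 2) ^ ((r : ℝ) + 1 / 2 - 1) = (x ^ 2 / η) ^ r * (Real.sqrt η / x) := by
    have : (r : ℝ) + 1 / 2 - 1 = r + (-(1 / 2)) := by ring
    rw [this, Real.rpow_add hy, Real.rpow_natCast, Real.rpow_neg hy.le, ← Real.sqrt_eq_rpow,
      Real.sqrt_mul (by positivity), Real.sqrt_sq hx.le, Real.sqrt_inv, div_eq_inv_mul (x ^ 2)]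
    field_simp
  have h2 : (1 / 2 : ℝ) ^ ((r : ℝ) + 1 / 2) = (1 / 2) ^ r * (Real.sqrt 2)⁻¹ := by
    rw [Real.rpow_add (by norm_num), Real.rpow_natCast, ← Real.sqrt_eq_rpow]
    simp
  have h3 : Real.sqrt (2 * Real.pi * η) = Real.sqrt 2 * Real.sqrt Real.pi * Real.sqrt η := by
    rw [Real.sqrt_mul (by positivity), Real.sqrt_mul (by positivity)]
  have h4 : -(1 / 2 * (η⁻¹ * x ^ 2)) = -(x ^ 2) / (2 * η) := by field_simp
  have hP : (∏ i ∈ Finset.range r, (2 * (i : ℝ) + 1)) ≠ 0 :=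
    Finset.prod_ne_zero_iff.2 fun i _ => by positivity
  have hsη := (Real.sqrt_pos.2 hη).ne'
  have hsp := (Real.sqrt_pos.2 Real.pi_pos).ne'
  have hs2 : Real.sqrt 2 ≠ 0 := by positivity
  have hη' : Real.sqrt η ^ 2 = η := Real.sq_sqrt hη.le
  rw [h1, h2, h3, h4]
  generalize Real.exp (-(x ^ 2) / (2 * η)) = E
  generalize (x ^ 2 / η) ^ r = Q
  have : η⁻¹ = (Real.sqrt η)⁻¹ * (Real.sqrt η)⁻¹ := by
    rw [← mul_inv, ← sq, hη']
  rw [this]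
  generalize Real.sqrt η = s at *
  rw [one_div, inv_pow]
  field_simp

lemma integrable_psi (r : ℕ) {η : ℝ} (hη : 0 < η) : Integrable fun y => psi r y η := by
  have h := (integrable_rpow_mul_exp_neg_mul_sq (b := 1 / (2 * η)) (by positivity)
    (s := ((2 * r : ℕ) : ℝ)) (by have : (0 : ℝ) ≤ ((2 * r : ℕ) : ℝ) := by positivity
                                 linarith)).const_mul
    ((∏ i ∈ Finset.range r, (2 * (i : ℝ) + 1))⁻¹ * (η⁻¹) ^ r * (Real.sqrt (2 * Real.pi * η))⁻¹)
  refine h.congr (Filter.Eventually.of_forall fun y => ?_)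
  simp only [psi, gaussDensity, Real.rpow_natCast]
  rw [pow_mul, div_eq_mul_inv (y ^ 2) η, mul_pow]
  have : -(1 / (2 * η)) * y ^ 2 = -(y ^ 2) / (2 * η) := by field_simp
  rw [this]
  ring

/-- If `Y` has density `psi r · η`, then `Y²/η` has the gamma law of shape `r + 1/2` and rate `1/2`:
fold by evenness, then substitute `y = x²` and rescale. -/
lemma integral_cexp_sq_mul_psi (r : ℕ) {η : ℝ} (hη : 0 < η) (t : ℝ) :
    ∫ x : ℝ, Complex.exp (t * (x ^ 2 / η : ℝ) * Complex.I) * (psi r x η : ℂ)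
      = charFun (gammaMeasure (r + 1 / 2) (1 / 2)) t := by
  have hi : Integrable fun x : ℝ =>
      Complex.exp (t * (x ^ 2 / η : ℝ) * Complex.I) * (psi r x η : ℂ) := by
    refine Integrable.bdd_mul (c := 1) (integrable_psi r hη).ofReal ?_ ?_
    · exact Continuous.aestronglyMeasurable (by fun_prop)
    · refine Filter.Eventually.of_forall fun x => ?_
      rw [← Complex.ofReal_mul, Complex.norm_exp_ofReal_mul_I]
  rw [integral_eq_two_mul_of_even hi (by intro x; simp [psi, gaussDensity])]
  have ha : (0 : ℝ) < r + 1 / 2 := by positivity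
  have h1 : gammaMeasure (r + 1 / 2) (1 / 2) =
      volume.withDensity fun x => ENNReal.ofReal (gammaPDFReal (r + 1 / 2) (1 / 2) x) := rfl
  rw [charFun_apply_real, h1, integral_withDensity_eq_integral_toReal_smul (by fun_prop) (by simp)]
  let g : ℝ → ℂ := fun y => (gammaPDFReal (r + 1 / 2) (1 / 2) y : ℂ)
    * Complex.exp (t * y * Complex.I)
  have h2 : ∀ y : ℝ, (ENNReal.ofReal (gammaPDFReal (r + 1 / 2) (1 / 2) y)).toReal •
      Complex.exp (t * y * Complex.I) = (Set.Ici (0 : ℝ)).indicator g y := by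
    intro y
    rw [ENNReal.toReal_ofReal (gammaPDFReal_nonneg ha (by norm_num) y), Set.indicator_apply]
    by_cases hy : 0 ≤ y
    · simp [hy, g]
    · simp [hy, gammaPDFReal]
  simp_rw [h2]
  rw [integral_indicator measurableSet_Ici, integral_Ici_eq_integral_Ioi]
  have h3 := integral_comp_mul_left_Ioi g 0 (inv_pos.2 hη)
  rw [mul_zero, inv_inv] at h3
  have h4 := integral_comp_rpow_Ioi_of_pos (g := fun y => (η⁻¹ : ℂ) * g (η⁻¹ * y))
    (p := 2) (by norm_num)
  rw [integral_const_mul, h3] at h4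
  have h5 : (η⁻¹ : ℂ) * (η • ∫ y in Set.Ioi (0 : ℝ), g y) = ∫ y in Set.Ioi (0 : ℝ), g y := by
    rw [Complex.real_smul, ← mul_assoc, inv_mul_cancel₀ (by exact_mod_cast hη.ne'), one_mul]
  rw [h5] at h4
  rw [← h4, ← integral_const_mul]
  refine setIntegral_congr_fun measurableSet_Ioi fun x (hx : 0 < x) => ?_
  have h6 := two_mul_psi_eq r hx hη
  have h7 : x ^ (2 : ℝ) = x ^ 2 := Real.rpow_two x
  have h8 : x ^ ((2 : ℝ) - 1) = x := by norm_num
  simp only [g, h7, h8, Complex.real_smul]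
  have h9 : (2 : ℂ) * psi r x η
      = (2 * x) * (η⁻¹ * gammaPDFReal (r + 1 / 2) (1 / 2) (η⁻¹ * x ^ 2)) := by
    exact_mod_cast congrArg ((↑) : ℝ → ℂ) h6
  have h10 : (x ^ 2 / η : ℝ) = η⁻¹ * x ^ 2 := by ring
  rw [h10, mul_left_comm, h9]
  push_cast
  ring

/-- On the diagonal, `Phi` only depends on the total degree. -/
lemma Phi_const {v : ℕ} [NeZero v] {ρ lt : ℝ} (hlt : 0 < lt) (m : Fin v → ℕ) :
    Phi ρ (fun _ => lt) m = chiSqCDF (v + 2 * ∑ i, m i) (ρ / lt) := by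
  set f : (Fin v → ℝ) → ℝ := fun x => ∏ i, psi (m i) (x i) lt with hf
  have hf0 : ∀ x, 0 ≤ f x := fun x => Finset.prod_nonneg fun i _ => psi_nonneg _ _ hlt
  have hfi : Integrable f := Integrable.fintype_prod fun i => integrable_psi (m i) hlt
  have hfc : Continuous f := continuous_prod_psi (fun _ => lt) m
  let M : Measure (Fin v → ℝ) := volume.withDensity fun x => ENNReal.ofReal (f x)
  have hMfin : IsFiniteMeasure M := isFiniteMeasure_withDensity_ofReal hfi.2
  let S : (Fin v → ℝ) → ℝ := fun x => ∑ i, x i ^ 2 / lt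
  have hS : Measurable S := by fun_prop
  set A : ℝ := ∑ i, ((m i : ℝ) + 1 / 2) with hA
  have hpos : ∀ i, 0 < (m i : ℝ) + 1 / 2 := fun i => by positivity
  have hApos : 0 < A := Finset.sum_pos (fun i _ => hpos i) Finset.univ_nonempty
  have hprob : IsProbabilityMeasure (gammaMeasure A (1 / 2)) :=
    isProbabilityMeasure_gammaMeasure hApos (by norm_num)
  -- `S` is a sum of independent gamma variables of shapes `m i + 1/2`; the integral of the
  -- character splits into a product over the coordinates.
  have hlaw : M.map S = gammaMeasure A (1 / 2) := by
    refine Measure.ext_of_charFun (funext fun t => ?_)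
    rw [← prod_charFun_gammaMeasure Finset.univ_nonempty _ hpos, charFun_apply_real,
      integral_map hS.aemeasurable (Continuous.aestronglyMeasurable (by fun_prop)),
      integral_withDensity_eq_integral_toReal_smul (by fun_prop) (by simp)]
    simp_rw [← integral_cexp_sq_mul_psi _ hlt]
    rw [← integral_fintype_prod_volume_eq_prod
      (fun (i : Fin v) (x : ℝ) => Complex.exp (t * (x ^ 2 / lt : ℝ) * Complex.I) *
        (psi (m i) x lt : ℂ))]
    congr 1
    ext x
    rw [ENNReal.toReal_ofReal (hf0 x), Finset.prod_mul_distrib, ← Complex.exp_sum,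
      Complex.real_smul, mul_comm]
    congr 2
    · rw [← Finset.sum_mul, ← Finset.mul_sum]
      simp [S]
    · simp [f]
  have hAe : A = ((v + 2 * ∑ i, m i : ℕ) : ℝ) / 2 := by
    rw [hA, Finset.sum_add_distrib]
    push_cast
    simp
    ring
  have hball : sqBall v ρ = S ⁻¹' Set.Iio (ρ / lt) := by
    ext x
    simp only [sqBall, S, Set.mem_ofPred_eq, Set.mem_preimage, Set.mem_Iio, ← Finset.sum_div]
    rw [div_lt_div_iff_of_pos_right hlt]
  -- The ball is open while the distribution function counts a closed half-line, so the endpoint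
  -- must carry no mass.
  have hnull : gammaMeasure A (1 / 2) {ρ / lt} = 0 :=
    (withDensity_absolutelyContinuous volume _) (by simp)
  rw [chiSqCDF, ← hAe, cdf_eq_real, Phi]
  have h1 : (gammaMeasure A (1 / 2)).real (Set.Iic (ρ / lt))
      = (gammaMeasure A (1 / 2)).real (Set.Iio (ρ / lt)) := by
    refine measureReal_congr ?_
    exact (Iio_ae_eq_Iic' hnull).symm
  rw [h1, ← hlaw, map_measureReal_apply hS measurableSet_Iio, ← hball, measureReal_def,
    withDensity_apply _ (measurableSet_sqBall v ρ)]
  rw [integral_eq_lintegral_of_nonneg_ae (Filter.Eventually.of_forall hf0)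
    hfc.aestronglyMeasurable]

lemma chiSqCDF_pos {ν : ℕ} (hν : 0 < ν) {x : ℝ} (hx : 0 < x) : 0 < chiSqCDF ν x := by
  have ha : (0 : ℝ) < (ν : ℝ) / 2 := by positivity
  rw [chiSqCDF, cdf_gammaMeasure_eq_integral ha (by norm_num)]
  have hprob : IsProbabilityMeasure (gammaMeasure ((ν : ℝ) / 2) (1 / 2)) :=
    isProbabilityMeasure_gammaMeasure ha (by norm_num)
  have hint : Integrable (gammaPDFReal ((ν : ℝ) / 2) (1 / 2)) := by
    refine ⟨by fun_prop, ?_⟩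
    rw [hasFiniteIntegral_iff_ofReal (Filter.Eventually.of_forall
      (gammaPDFReal_nonneg ha (by norm_num)))]
    have := lintegral_gammaPDF_eq_one ha (show (0 : ℝ) < 1 / 2 by norm_num)
    simp only [gammaPDF] at this
    rw [this]
    exact ENNReal.one_lt_top
  rw [setIntegral_pos_iff_support_of_nonneg_ae
    (Filter.Eventually.of_forall (gammaPDFReal_nonneg ha (by norm_num))) hint.integrableOn]
  have hsub : Set.Ioo 0 x ⊆
      Function.support (gammaPDFReal ((ν : ℝ) / 2) (1 / 2)) ∩ Set.Iic x := fun y hy =>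
    ⟨(gammaPDFReal_pos ha (by norm_num) hy.1).ne', hy.2.le⟩
  refine lt_of_lt_of_le ?_ (measure_mono hsub)
  simpa using hx

lemma tendsto_chiSqCDF (ν : ℕ) (hν : 0 < ν) :
    Filter.Tendsto (chiSqCDF ν) Filter.atTop (nhds 1) := by
  have hprob : IsProbabilityMeasure (gammaMeasure ((ν : ℝ) / 2) (1 / 2)) :=
    isProbabilityMeasure_gammaMeasure (by positivity) (by norm_num)
  exact tendsto_cdf_atTop _

/-! ### Taylor series at the origin -/

/-- The Taylor series at `0` of a function of a real variable. -/
def taylorSeries (f : ℝ → ℝ) : PowerSeries ℝ :=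
  PowerSeries.mk fun d => iteratedDeriv d f 0 / (d.factorial : ℝ)

/-- Smoothness at `0`. -/
def SmoothZero (f : ℝ → ℝ) : Prop := ∀ N : ℕ, ContDiffAt ℝ N f 0

lemma coeff_taylorSeries (d : ℕ) (f : ℝ → ℝ) :
    PowerSeries.coeff d (taylorSeries f) = iteratedDeriv d f 0 / (d.factorial : ℝ) := by
  simp [taylorSeries]

lemma taylorSeries_congr {f g : ℝ → ℝ} (h : f =ᶠ[nhds 0] g) :
    taylorSeries f = taylorSeries g := by
  ext d
  rw [coeff_taylorSeries, coeff_taylorSeries, h.iteratedDeriv_eq]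

lemma derivative_taylorSeries (f : ℝ → ℝ) :
    PowerSeries.derivative ℝ (taylorSeries f) = taylorSeries (deriv f) := by
  ext d
  rw [PowerSeries.coeff_derivative, coeff_taylorSeries, coeff_taylorSeries, iteratedDeriv_succ',
    Nat.factorial_succ]
  have : (d.factorial : ℝ) ≠ 0 := by positivity
  push_cast
  field_simp

lemma taylorSeries_mul {f g : ℝ → ℝ} (hf : SmoothZero f) (hg : SmoothZero g) :
    taylorSeries (fun ε => f ε * g ε) = taylorSeries f * taylorSeries g := by
  ext d
  have h := iteratedDeriv_mul (hf d) (hg d)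
  have e : (fun ε => f ε * g ε) = f * g := rfl
  rw [coeff_taylorSeries, e, h, PowerSeries.coeff_mul, Finset.sum_div,
    Finset.Nat.sum_antidiagonal_eq_sum_range_succ_mk]
  refine Finset.sum_congr rfl fun i hi => ?_
  rw [coeff_taylorSeries, coeff_taylorSeries, Nat.cast_choose _ (by grind)]
  have h1 : (d.factorial : ℝ) ≠ 0 := by positivity
  have h2 : (i.factorial : ℝ) ≠ 0 := by positivity
  have h3 : ((d - i).factorial : ℝ) ≠ 0 := by positivity
  field_simp

lemma SmoothZero.mul {f g : ℝ → ℝ} (hf : SmoothZero f) (hg : SmoothZero g) :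
    SmoothZero fun ε => f ε * g ε := fun N => (hf N).mul (hg N)

lemma SmoothZero.sub {f g : ℝ → ℝ} (hf : SmoothZero f) (hg : SmoothZero g) :
    SmoothZero fun ε => f ε - g ε := fun N => (hf N).sub (hg N)

lemma SmoothZero.div {f g : ℝ → ℝ} (hf : SmoothZero f) (hg : SmoothZero g) (h : g 0 ≠ 0) :
    SmoothZero fun ε => f ε / g ε := fun N => (hf N).div (hg N) h

lemma SmoothZero.of_contDiff {f : ℝ → ℝ} (h : ContDiff ℝ ⊤ f) : SmoothZero f :=
  fun _ => (h.of_le le_top).contDiffAt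

lemma taylorSeries_sub {f g : ℝ → ℝ} (hf : SmoothZero f) (hg : SmoothZero g) :
    taylorSeries (fun ε => f ε - g ε) = taylorSeries f - taylorSeries g := by
  ext d
  rw [map_sub, coeff_taylorSeries, coeff_taylorSeries, coeff_taylorSeries,
    iteratedDeriv_fun_sub (hf d) (hg d), sub_div]

lemma taylorSeries_sum {ι : Type*} (s : Finset ι) {f : ι → ℝ → ℝ}
    (hf : ∀ i, SmoothZero (f i)) :
    taylorSeries (fun ε => ∑ i ∈ s, f i ε) = ∑ i ∈ s, taylorSeries (f i) := by
  ext d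
  rw [map_sum, coeff_taylorSeries, iteratedDeriv_fun_sum (fun i _ => hf i d), Finset.sum_div]
  simp_rw [coeff_taylorSeries]

lemma taylorSeries_const (c : ℝ) : taylorSeries (fun _ => c) = PowerSeries.C c := by
  ext d
  rw [coeff_taylorSeries, iteratedDeriv_const, PowerSeries.coeff_C]
  split_ifs with h <;> simp [h]

lemma taylorSeries_pow_mul (j : ℕ) (c : ℝ) :
    taylorSeries (fun ε => ε ^ j * c) = PowerSeries.X ^ j * PowerSeries.C c := by
  have hid : SmoothZero fun ε : ℝ => ε := SmoothZero.of_contDiff contDiff_id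
  have hX : taylorSeries (fun ε => ε) = PowerSeries.X := by
    have h1 := derivative_taylorSeries fun ε => ε
    have h2 : deriv (fun ε : ℝ => ε) = fun _ => 1 := by ext; simp
    rw [h2, taylorSeries_const] at h1
    ext d
    cases d with
    | zero => simp [coeff_taylorSeries]
    | succ d =>
      have := congrArg (PowerSeries.coeff d) h1
      rw [PowerSeries.coeff_derivative, PowerSeries.coeff_C] at this
      rw [PowerSeries.coeff_X]
      have hd : (d : ℝ) + 1 ≠ 0 := by positivity
      by_cases h0 : d = 0
      · subst h0; simpa using this
      · simp only [h0, if_false] at this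
        simpa [h0, hd] using this
  induction j with
  | zero => simp [taylorSeries_const]
  | succ j ih =>
    have hs : SmoothZero fun ε : ℝ => ε ^ j * c :=
      SmoothZero.of_contDiff ((contDiff_id.pow j).mul contDiff_const)
    have e : (fun ε : ℝ => ε ^ (j + 1) * c) = fun ε => ε * (ε ^ j * c) := by
      ext; ring
    rw [e, taylorSeries_mul hid hs, ih, hX]
    ring

/-! ### The formal solution over `ℝ[X]` -/

/-- Coefficients of the solution of the linear equation `Y' = Y Z` with `Y(0) = 1`. -/
def odeCoef {R : Type*} [CommRing R] [Algebra ℝ R] (z : ℕ → R) : ℕ → R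
  | 0 => 1
  | d + 1 => ((1 : ℝ) / (d + 1)) • ∑ e : Fin (d + 1), odeCoef z e * z (d - e)
decreasing_by exact e.2

lemma odeCoef_zero {R : Type*} [CommRing R] [Algebra ℝ R] (z : ℕ → R) : odeCoef z 0 = 1 := by
  rw [odeCoef]

lemma odeCoef_succ {R : Type*} [CommRing R] [Algebra ℝ R] (z : ℕ → R) (d : ℕ) :
    odeCoef z (d + 1) =
      ((1 : ℝ) / (d + 1)) • ∑ e ∈ Finset.range (d + 1), odeCoef z e * z (d - e) := by
  rw [odeCoef, Finset.sum_range (fun e => odeCoef z e * z (d - e))]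

lemma derivative_mk_odeCoef {R : Type*} [CommRing R] [Algebra ℝ R] (Z : PowerSeries R) :
    PowerSeries.derivative R (PowerSeries.mk (odeCoef fun d => PowerSeries.coeff d Z))
      = PowerSeries.mk (odeCoef fun d => PowerSeries.coeff d Z) * Z := by
  ext d
  rw [PowerSeries.coeff_derivative, PowerSeries.coeff_mul,
    Finset.Nat.sum_antidiagonal_eq_sum_range_succ_mk, PowerSeries.coeff_mk, odeCoef_succ]
  simp only [PowerSeries.coeff_mk]
  have : ((d : R) + 1) = algebraMap ℝ R (d + 1) := by simp
  rw [this, mul_comm, ← Algebra.smul_def, smul_smul, mul_one_div_cancel (by positivity), one_smul]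

lemma derivative_mul' {R : Type*} [CommRing R] (f g : PowerSeries R) :
    PowerSeries.derivative R (f * g) =
      f * PowerSeries.derivative R g + g * PowerSeries.derivative R f :=
  Derivation.leibniz _ f g

lemma derivative_pow_succ {R : Type*} [CommRing R] (f : PowerSeries R) (r : ℕ) :
    PowerSeries.derivative R (f ^ (r + 1)) =
      (r + 1 : PowerSeries R) * f ^ r * PowerSeries.derivative R f := by
  rw [Derivation.leibniz_pow]
  simp only [smul_eq_mul, nsmul_eq_mul, Nat.add_sub_cancel]
  push_cast
  ring

lemma derivative_one' {R : Type*} [CommRing R] :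
    PowerSeries.derivative R (1 : PowerSeries R) = 0 := Derivation.map_one_eq_zero _

section formal

variable {v : ℕ} (n : ℕ) (lt : ℝ) (lam : ℕ → Fin v → ℝ)

/-- The relative perturbation of `λ_i` as a power series. -/
def delta (i : Fin v) : PowerSeries ℝ :=
  PowerSeries.mk fun j => if 1 ≤ j ∧ j ≤ n then lam j i / lt else 0

open Polynomial in
/-- The relative perturbation of `λ_i`, with polynomial coefficients. -/
def deltaP (i : Fin v) : PowerSeries ℝ[X] := PowerSeries.map Polynomial.C (delta n lt lam i)

open Polynomial in
/-- The variable `1 - X`. -/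
def uP : PowerSeries ℝ[X] := PowerSeries.C (1 - X)

open Polynomial in
/-- The inverse of `1 + δ_i (1 - X)`. -/
def invP (i : Fin v) : PowerSeries ℝ[X] :=
  PowerSeries.invOfUnit (1 + deltaP n lt lam i * uP) 1

open Polynomial in
/-- The logarithmic derivative of `∏ i, (1 + δ_i (1 - X)) ^ (-1/2)`. -/
def logDerivP : PowerSeries ℝ[X] :=
  PowerSeries.C (C (-(1 / 2))) *
    ∑ i, PowerSeries.derivative ℝ[X] (deltaP n lt lam i) * uP * invP n lt lam i

open Polynomial in
/-- The power series `∏ i, (1 + δ_i (1 - X)) ^ (-1/2)`. -/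
def rootP : PowerSeries ℝ[X] :=
  PowerSeries.mk (odeCoef fun d => PowerSeries.coeff d (logDerivP n lt lam))

lemma derivative_rootP :
    PowerSeries.derivative _ (rootP n lt lam) = rootP n lt lam * logDerivP n lt lam :=
  derivative_mk_odeCoef _

lemma constantCoeff_deltaP (i : Fin v) :
    PowerSeries.constantCoeff (deltaP n lt lam i) = 0 := by
  simp [deltaP, delta, ← PowerSeries.coeff_zero_eq_constantCoeff_apply]

lemma mul_invP (i : Fin v) : (1 + deltaP n lt lam i * uP) * invP n lt lam i = 1 := by
  refine PowerSeries.mul_invOfUnit _ _ ?_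
  simp [constantCoeff_deltaP]

lemma derivative_invP (i : Fin v) :
    PowerSeries.derivative _ (invP n lt lam i) = invP n lt lam i *
      -(PowerSeries.derivative _ (deltaP n lt lam i) * uP * invP n lt lam i) := by
  have h := mul_invP n lt lam i
  have hu : PowerSeries.derivative (Polynomial ℝ) uP = 0 := by
    rw [uP]; exact PowerSeries.derivative_C
  have h' := congrArg (PowerSeries.derivative (Polynomial ℝ)) h
  rw [derivative_mul', map_add, derivative_mul', hu, derivative_one'] at h'
  simp only [mul_zero, zero_add] at h'
  set q := invP n lt lam i
  set D := PowerSeries.derivative (Polynomial ℝ) (deltaP n lt lam i)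
  linear_combination (q) * h' - (PowerSeries.derivative (Polynomial ℝ) q) * h

lemma derivative_prod_invP (m : Fin v → ℕ) (s : Finset (Fin v)) :
    PowerSeries.derivative _ (∏ i ∈ s, invP n lt lam i ^ m i) = (∏ i ∈ s, invP n lt lam i ^ m i) *
      -∑ i ∈ s, (m i : PowerSeries (Polynomial ℝ)) *
        (PowerSeries.derivative _ (deltaP n lt lam i) * uP * invP n lt lam i) := by
  classical
  induction s using Finset.induction_on with
  | empty => simp
  | insert i s hi ih =>
    rw [Finset.prod_insert hi, Finset.sum_insert hi, derivative_mul', ih]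
    cases hm : m i with
    | zero => simp
    | succ r =>
      rw [derivative_pow_succ, derivative_invP]
      push_cast
      ring

open Polynomial in
/-- The formal counterpart of `Phi`. -/
def PhiP (m : Fin v → ℕ) : PowerSeries ℝ[X] :=
  PowerSeries.C (X ^ ∑ i, m i) * rootP n lt lam * ∏ i, invP n lt lam i ^ m i

lemma PhiP_bump (m : Fin v → ℕ) (i : Fin v) :
    PhiP n lt lam (m + Pi.single i 1) = PhiP n lt lam m *
      (PowerSeries.C Polynomial.X * invP n lt lam i) := by
  have h1 : ∑ j, (m + Pi.single i 1 : Fin v → ℕ) j = ∑ j, m j + 1 := by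
    simp [Finset.sum_add_distrib]
  have h2 : ∏ j, invP n lt lam j ^ (m + Pi.single i 1 : Fin v → ℕ) j
      = (∏ j, invP n lt lam j ^ m j) * invP n lt lam i := by
    simp only [Pi.add_apply, pow_add, Finset.prod_mul_distrib]
    congr 1
    rw [Finset.prod_eq_single i] <;> simp +contextual
  rw [PhiP, PhiP, h1, h2, pow_succ, map_mul]
  ring

/-- Here `g i` is the logarithmic derivative of `1 + δ_i`. With `q_i` the inverse of `1 + δ_i(1 -
X)`, raising `m i` multiplies by `X q_i`, and `X q_i - 1 = -(1 - X)(1 + δ_i) q_i`; so the system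
satisfied by `Phi` is the logarithmic derivative of an explicit product. -/
lemma derivative_PhiP (g : Fin v → PowerSeries ℝ)
    (hg : ∀ i, g i * (1 + delta n lt lam i) = PowerSeries.derivative ℝ (delta n lt lam i))
    (m : Fin v → ℕ) :
    PowerSeries.derivative _ (PhiP n lt lam m) =
      ∑ i, PowerSeries.map Polynomial.C (PowerSeries.C ((m i : ℝ) + 1 / 2) * g i) *
        (PhiP n lt lam (m + Pi.single i 1) - PhiP n lt lam m) := by
  have hgP : ∀ i, PowerSeries.map Polynomial.C (g i) * (1 + deltaP n lt lam i)
      = PowerSeries.derivative _ (deltaP n lt lam i) := by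
    intro i
    rw [deltaP, ← map_one (PowerSeries.map (Polynomial.C (R := ℝ))), ← map_add, ← map_mul, hg i]
    ext1 d
    simp [PowerSeries.coeff_derivative]
  have hterm : ∀ i, PowerSeries.map Polynomial.C (PowerSeries.C ((m i : ℝ) + 1 / 2) * g i) *
        (PhiP n lt lam (m + Pi.single i 1) - PhiP n lt lam m)
      = PhiP n lt lam m * (-((m i : PowerSeries (Polynomial ℝ)) *
          (PowerSeries.derivative _ (deltaP n lt lam i) * uP * invP n lt lam i))
        + PowerSeries.C (Polynomial.C (-(1 / 2))) *
          (PowerSeries.derivative _ (deltaP n lt lam i) * uP * invP n lt lam i)) := by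
    intro i
    have h1 := mul_invP n lt lam i
    have hC : PowerSeries.map (Polynomial.C (R := ℝ)) (PowerSeries.C ((m i : ℝ) + 1 / 2))
        = (m i : PowerSeries (Polynomial ℝ)) - PowerSeries.C (Polynomial.C (-(1 / 2))) := by
      rw [PowerSeries.map_C, map_neg, map_neg, sub_neg_eq_add, map_add, map_add]
      congr 1
    have hX : (PowerSeries.C Polynomial.X : PowerSeries (Polynomial ℝ)) = 1 - uP := by
      simp [uP]
    rw [PhiP_bump, map_mul, hC, ← hgP i, hX]
    set q := invP n lt lam i
    set G := PowerSeries.map (Polynomial.C (R := ℝ)) (g i)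
    set h := (PowerSeries.C (Polynomial.C (-(1 / 2))) : PowerSeries (Polynomial ℝ))
    linear_combination
      (((m i : PowerSeries (Polynomial ℝ)) - h) * G * PhiP n lt lam m) * h1
  simp_rw [hterm]
  rw [← Finset.mul_sum, Finset.sum_add_distrib, Finset.sum_neg_distrib, ← Finset.mul_sum]
  rw [PhiP, derivative_mul', derivative_mul', derivative_rootP, derivative_prod_invP,
    PowerSeries.derivative_C, logDerivP]
  ring

end formal

/-! ### From formal series to the analytic integrals -/

open Polynomial in
/-- The linear functional `X ^ k ↦ F_{v + 2k}(x)`. -/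
def ell (v : ℕ) (x : ℝ) : ℝ[X] →ₗ[ℝ] ℝ :=
  Polynomial.lsum fun k => LinearMap.id.smulRight (chiSqCDF (v + 2 * k) x)

lemma ell_apply (v : ℕ) (x : ℝ) (p : Polynomial ℝ) :
    ell v x p = p.sum fun k a => a * chiSqCDF (v + 2 * k) x := by
  simp [ell, Polynomial.lsum_apply]

lemma ell_X_pow (v : ℕ) (x : ℝ) (k : ℕ) :
    ell v x (Polynomial.X ^ k) = chiSqCDF (v + 2 * k) x := by
  rw [ell_apply, ← Polynomial.monomial_one_right_eq_X_pow, Polynomial.sum_monomial_index] <;> simp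

lemma ell_C_mul (v : ℕ) (x a : ℝ) (p : Polynomial ℝ) :
    ell v x (Polynomial.C a * p) = a * ell v x p := by
  rw [Polynomial.C_mul', map_smul, smul_eq_mul]

/-- The functional `ell` applied to each coefficient of a power series. -/
def ellS (v : ℕ) (x : ℝ) (f : PowerSeries (Polynomial ℝ)) : PowerSeries ℝ :=
  PowerSeries.mk fun d => ell v x (PowerSeries.coeff d f)

section analytic

variable {v : ℕ} {n : ℕ} {lt : ℝ} {lam : ℕ → Fin v → ℝ}

lemma contDiff_path (i : Fin v) : ContDiff ℝ ⊤ fun ε => path n lam ε i := by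
  unfold path
  fun_prop

lemma hasDerivAt_path (ε : ℝ) (i : Fin v) :
    HasDerivAt (fun ε => path n lam ε i) (deriv (fun ε => path n lam ε i) ε) ε :=
  ((contDiff_path i).differentiable (by simp)).differentiableAt.hasDerivAt

lemma contDiff_deriv_path (i : Fin v) :
    ContDiff ℝ ⊤ fun ε => deriv (fun ε => path n lam ε i) ε := by
  have h := (contDiff_path (n := n) (lam := lam) i)
  exact ((contDiff_succ_iff_deriv (n := ⊤)).1 (by simpa using h)).2.2

lemma path_zero (i : Fin v) : path n lam 0 i = lam 0 i := by
  rw [path, Finset.sum_range_succ']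
  simp

lemma taylorSeries_path (hlt : 0 < lt) (h0 : ∀ i, lam 0 i = lt) (i : Fin v) :
    taylorSeries (fun ε => path n lam ε i) = PowerSeries.C lt * (1 + delta n lt lam i) := by
  unfold path
  rw [taylorSeries_sum _ fun j => SmoothZero.of_contDiff (by fun_prop)]
  simp_rw [taylorSeries_pow_mul]
  ext d
  rw [map_sum, PowerSeries.coeff_C_mul, map_add, delta, PowerSeries.coeff_mk, PowerSeries.coeff_one]
  simp_rw [PowerSeries.coeff_mul_C, PowerSeries.coeff_X_pow, ite_mul, one_mul, zero_mul]
  rw [Finset.sum_ite_eq]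
  have := hlt.ne'
  by_cases hd : d = 0
  · subst hd; simp [h0]
  · have : 1 ≤ d := by omega
    simp only [Finset.mem_range, Nat.lt_succ_iff, hd, if_false, zero_add, this, true_and]
    split_ifs
    · field_simp
    · simp

/-- Taylor series of the integrals along the path, in terms of chi-squared functions. -/
theorem taylorSeries_Phi [NeZero v] {ρ : ℝ} (hlt : 0 < lt) (h0 : ∀ i, lam 0 i = lt)
    (m : Fin v → ℕ) :
    taylorSeries (fun ε => Phi ρ (path n lam ε) m) = ellS v (ρ / lt) (PhiP n lt lam m) := by
  have hpos0 : ∀ i, 0 < path n lam 0 i := fun i => by rw [path_zero, h0]; exact hlt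
  have hopen : IsOpen {ε | ∀ i, 0 < path n lam ε i} := by
    simp only [Set.ofPred_forall]
    exact isOpen_iInter_of_finite fun i => isOpen_lt continuous_const (contDiff_path i).continuous
  have hmem : {ε | ∀ i, 0 < path n lam ε i} ∈ nhds (0 : ℝ) := hopen.mem_nhds hpos0
  have hsm : ∀ m, SmoothZero fun ε => Phi ρ (path n lam ε) m := fun m N =>
    (contDiffOn_Phi ρ hasDerivAt_path contDiff_path contDiff_deriv_path N m).contDiffAt hmem
  let g : Fin v → ℝ → ℝ := fun i ε => deriv (fun ε => path n lam ε i) ε / path n lam ε i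
  have hgs : ∀ i, SmoothZero (g i) := fun i =>
    (SmoothZero.of_contDiff (contDiff_deriv_path i)).div (SmoothZero.of_contDiff (contDiff_path i))
      (hpos0 i).ne'
  have hg : ∀ i, taylorSeries (g i) * (1 + delta n lt lam i)
      = PowerSeries.derivative ℝ (delta n lt lam i) := by
    intro i
    have h1 : taylorSeries (fun ε => g i ε * path n lam ε i)
        = taylorSeries (deriv fun ε => path n lam ε i) := by
      refine taylorSeries_congr ?_
      filter_upwards [hmem] with ε hε
      exact div_mul_cancel₀ _ (hε i).ne'
    rw [taylorSeries_mul (hgs i) (SmoothZero.of_contDiff (contDiff_path i)),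
      ← derivative_taylorSeries, taylorSeries_path hlt h0, Derivation.leibniz, map_add,
      PowerSeries.derivative_C, Derivation.map_one_eq_zero] at h1
    simp only [smul_eq_mul, mul_zero, add_zero, zero_add] at h1
    have hC : (PowerSeries.C lt : PowerSeries ℝ) ≠ 0 := by
      rw [Ne, map_eq_zero_iff _ PowerSeries.C_injective]; exact hlt.ne'
    refine mul_left_cancel₀ hC ?_
    rw [← h1]
    ring
  have hode : ∀ m, PowerSeries.derivative ℝ (taylorSeries fun ε => Phi ρ (path n lam ε) m)
      = ∑ i, PowerSeries.C ((m i : ℝ) + 1 / 2) * taylorSeries (g i) *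
        (taylorSeries (fun ε => Phi ρ (path n lam ε) (m + Pi.single i 1))
          - taylorSeries (fun ε => Phi ρ (path n lam ε) m)) := by
    intro m
    have hc : ∀ i : Fin v, SmoothZero fun _ : ℝ => (m i : ℝ) + 1 / 2 := fun i =>
      SmoothZero.of_contDiff contDiff_const
    have h1 : taylorSeries (deriv fun ε => Phi ρ (path n lam ε) m)
        = taylorSeries fun ε => ∑ i, ((m i : ℝ) + 1 / 2) * g i ε *
          (Phi ρ (path n lam ε) (m + Pi.single i 1) - Phi ρ (path n lam ε) m) := by
      refine taylorSeries_congr ?_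
      filter_upwards [hmem] with ε hε
      rw [(hasDerivAt_Phi ρ hasDerivAt_path (fun i => (contDiff_deriv_path i).continuous)
        hε m).deriv]
      exact Finset.sum_congr rfl fun i _ => by simp only [g]; ring
    rw [derivative_taylorSeries, h1, taylorSeries_sum _ fun i =>
      ((hc i).mul (hgs i)).mul ((hsm _).sub (hsm _))]
    refine Finset.sum_congr rfl fun i _ => ?_
    rw [taylorSeries_mul ((hc i).mul (hgs i)) ((hsm _).sub (hsm _)),
      taylorSeries_mul (hc i) (hgs i), taylorSeries_const, taylorSeries_sub (hsm _) (hsm _)]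
  -- Both sides obey the same recursion, in which order `d + 1` at `m` involves only orders at most
  -- `d` at `m` and at its increments; hence strong induction with `m` free. The map `ell` is linear
  -- but not multiplicative, which suffices because the `g i` have scalar coefficients.
  have main : ∀ d m, PowerSeries.coeff d (taylorSeries fun ε => Phi ρ (path n lam ε) m)
      = ell v (ρ / lt) (PowerSeries.coeff d (PhiP n lt lam m)) := by
    intro d
    induction d using Nat.strong_induction_on with
    | _ d ih =>
      intro m
      cases d with
      | zero =>
        have hp : path n lam 0 = fun _ => lt := funext fun i => by rw [path_zero, h0]
        have hq : ∀ i, PowerSeries.constantCoeff (invP n lt lam i) = 1 := by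
          intro i
          simp [invP, PowerSeries.constantCoeff_invOfUnit]
        have hY : PowerSeries.constantCoeff (rootP n lt lam) = 1 := by
          rw [← PowerSeries.coeff_zero_eq_constantCoeff_apply, rootP, PowerSeries.coeff_mk,
            odeCoef_zero]
        have hP : PowerSeries.constantCoeff (PhiP n lt lam m) = Polynomial.X ^ ∑ i, m i := by
          simp [PhiP, hq, hY]
        rw [coeff_taylorSeries, PowerSeries.coeff_zero_eq_constantCoeff_apply, hP, ell_X_pow]
        simp only [iteratedDeriv_zero, hp, Phi_const hlt]
        simp
      | succ d =>
        have h1 := congrArg (PowerSeries.coeff d) (hode m)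
        have h2 := congrArg (PowerSeries.coeff d) (derivative_PhiP n lt lam _ hg m)
        have hd : (d : ℝ) + 1 ≠ 0 := by positivity
        rw [PowerSeries.coeff_derivative] at h1 h2
        refine mul_right_cancel₀ hd ?_
        have h3 : ell v (ρ / lt) (PowerSeries.coeff (d + 1) (PhiP n lt lam m)) * ((d : ℝ) + 1)
            = ell v (ρ / lt) (PowerSeries.coeff (d + 1) (PhiP n lt lam m) * ((d : Polynomial ℝ) + 1))
            := by
          have : ((d : Polynomial ℝ) + 1) = Polynomial.C ((d : ℝ) + 1) := by simp
          rw [this, mul_comm _ (Polynomial.C _), ell_C_mul, mul_comm]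
        rw [h1, h3, h2, map_sum, map_sum, map_sum]
        refine Finset.sum_congr rfl fun i _ => ?_
        rw [PowerSeries.coeff_mul, PowerSeries.coeff_mul, map_sum]
        refine Finset.sum_congr rfl fun p hp => ?_
        have hp2 : p.2 < d + 1 := by
          have := Finset.HasAntidiagonal.mem_antidiagonal.1 hp; omega
        rw [PowerSeries.coeff_map, ell_C_mul, map_sub, map_sub, map_sub, ih _ hp2, ih _ hp2]
  ext d
  rw [main, ellS, PowerSeries.coeff_mk]

lemma taylorSeries_alpha [NeZero v] {ρ : ℝ} (hlt : 0 < lt) (h0 : ∀ i, lam 0 i = lt) :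
    taylorSeries (fun ε => alpha ρ (path n lam ε)) = ellS v (ρ / lt) (rootP n lt lam) := by
  simp_rw [alpha_eq_Phi]
  rw [taylorSeries_Phi hlt h0]
  simp [PhiP]

/-- Taylor series of the ratio `R_k` along the path. -/
theorem taylorSeries_ratioR_mul [NeZero v] {ρ : ℝ} (hρ : 0 < ρ) (hlt : 0 < lt)
    (h0 : ∀ i, lam 0 i = lt) (k : Fin v) :
    taylorSeries (fun ε => ratioR ρ (path n lam ε) k) * ellS v (ρ / lt) (rootP n lt lam)
      = ellS v (ρ / lt)
        (PowerSeries.C Polynomial.X * rootP n lt lam * invP n lt lam k) := by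
  have hpos0 : ∀ i, 0 < path n lam 0 i := fun i => by rw [path_zero, h0]; exact hlt
  have hopen : IsOpen {ε | ∀ i, 0 < path n lam ε i} := by
    simp only [Set.ofPred_forall]
    exact isOpen_iInter_of_finite fun i => isOpen_lt continuous_const (contDiff_path i).continuous
  have hmem : {ε | ∀ i, 0 < path n lam ε i} ∈ nhds (0 : ℝ) := hopen.mem_nhds hpos0
  have hsm : ∀ m, SmoothZero fun ε => Phi ρ (path n lam ε) m := fun m N =>
    (contDiffOn_Phi ρ hasDerivAt_path contDiff_path contDiff_deriv_path N m).contDiffAt hmem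
  have hp : path n lam 0 = fun _ => lt := funext fun i => by rw [path_zero, h0]
  have hne : Phi ρ (path n lam 0) 0 ≠ 0 := by
    rw [hp, Phi_const hlt]
    exact (chiSqCDF_pos (by have := NeZero.pos v; omega) (div_pos hρ hlt)).ne'
  have h1 : (fun ε => ratioR ρ (path n lam ε) k) =
      fun ε => Phi ρ (path n lam ε) (Pi.single k 1) / Phi ρ (path n lam ε) 0 := by
    ext ε
    rw [ratioR, alphaK_eq_Phi, alpha_eq_Phi]
  rw [← taylorSeries_alpha hlt h0]
  simp_rw [alpha_eq_Phi]
  rw [h1, ← taylorSeries_mul ((hsm _).div (hsm _) hne) (hsm _)]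
  have h2 : taylorSeries (fun ε => Phi ρ (path n lam ε) (Pi.single k 1) / Phi ρ (path n lam ε) 0 *
      Phi ρ (path n lam ε) 0) = taylorSeries fun ε => Phi ρ (path n lam ε) (Pi.single k 1) := by
    refine taylorSeries_congr ?_
    filter_upwards [(hsm 0 0).continuousAt.eventually_ne hne] with ε hε
    exact div_mul_cancel₀ _ hε
  rw [h2, taylorSeries_Phi hlt h0]
  have h3 := PhiP_bump n lt lam 0 k
  rw [zero_add] at h3
  rw [h3]
  congr 1
  simp only [PhiP, Pi.zero_apply, Finset.sum_const_zero, pow_zero, Finset.prod_const_one, mul_one,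
    map_one, one_mul]
  ring

end analytic

/-! ### Spans of structures and bookkeeping of the order-`n` perturbation -/

/-- The data on which the source term depends: dimension, square radius, common eigenvalue,
perturbations, and direction. -/
structure Datum where
  v : ℕ
  ρ : ℝ
  lt : ℝ
  hρ : 0 < ρ
  hlt : 0 < lt
  lam : ℕ → Fin v → ℝ
  h0 : ∀ i, lam 0 i = lt
  k : Fin v

/-- Relative perturbation of order `j` in the direction `i`. -/
def Datum.rel (x : Datum) (j : ℕ) (i : Fin x.v) : ℝ := x.lam j i / x.lt

/-- Change of direction. -/
def Datum.turn (x : Datum) (i : Fin x.v) : Datum := { x with k := i }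

/-- The structure `(b, T)` evaluated on relative perturbations. -/
def structVal (b : Multiset ℕ) (T : Multiset (Multiset ℕ)) (x : Datum) : ℝ :=
  (b.map fun j => x.rel j x.k).prod * (T.map fun t => ∑ i, (t.map fun j => x.rel j i).prod).prod

/-- The structures of perturbative order `d` built from orders in `{1, …, n - 1}`. -/
def IsStruct (n d : ℕ) (b : Multiset ℕ) (T : Multiset (Multiset ℕ)) : Prop :=
  (∀ j ∈ b, 1 ≤ j ∧ j < n) ∧ (∀ t ∈ T, t ≠ 0) ∧ (∀ t ∈ T, ∀ j ∈ t, 1 ≤ j ∧ j < n) ∧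
    b.sum + (T.map Multiset.sum).sum = d

section span

variable {R : Type*} [CommRing R] [Algebra ℝ R]

/-- The span of the products of a structure of order `d` and an element of `S`. -/
def structSpan (S : Set (Datum → R)) (n d : ℕ) : Submodule ℝ (Datum → R) :=
  Submodule.span ℝ {h | ∃ b T, IsStruct n d b T ∧ ∃ s ∈ S, h = fun x => structVal b T x • s x}

lemma structSpan_mono {S S' : Set (Datum → R)} (h : S ⊆ S') (n d : ℕ) :
    structSpan S n d ≤ structSpan S' n d :=
  Submodule.span_mono fun _ ⟨b, T, hb, s, hs, e⟩ => ⟨b, T, hb, s, h hs, e⟩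

lemma structSpan_mul {S S' S'' : Set (Datum → R)} (hS : ∀ s ∈ S, ∀ s' ∈ S', s * s' ∈ S'')
    {n d d' : ℕ} {f g : Datum → R} (hf : f ∈ structSpan S n d) (hg : g ∈ structSpan S' n d') :
    f * g ∈ structSpan S'' n (d + d') := by
  have h := Submodule.mul_mem_mul hf hg
  rw [structSpan, structSpan, Submodule.span_mul_span] at h
  refine Submodule.span_mono ?_ h
  rintro _ ⟨_, ⟨b, T, hb, s, hs, rfl⟩, _, ⟨b', T', hb', s', hs', rfl⟩, rfl⟩
  refine ⟨b + b', T + T', ⟨?_, ?_, ?_, ?_⟩, s * s', hS s hs s' hs', ?_⟩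
  · exact fun j hj => (Multiset.mem_add.1 hj).elim (hb.1 j) (hb'.1 j)
  · exact fun t ht => (Multiset.mem_add.1 ht).elim (hb.2.1 t) (hb'.2.1 t)
  · exact fun t ht => (Multiset.mem_add.1 ht).elim (hb.2.2.1 t) (hb'.2.2.1 t)
  · rw [Multiset.sum_add, Multiset.map_add, Multiset.sum_add, ← hb.2.2.2, ← hb'.2.2.2]
    omega
  · ext1 x
    simp only [Pi.mul_apply, structVal, Multiset.map_add, Multiset.prod_add]
    rw [smul_mul_smul_comm]
    congr 1
    ring

lemma mem_structSpan_zero {S : Set (Datum → R)} {s : Datum → R} (hs : s ∈ S) (n : ℕ) :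
    s ∈ structSpan S n 0 :=
  Submodule.subset_span ⟨0, 0, ⟨by simp, by simp, by simp, by simp⟩, s, hs, by
    ext1 x; simp [structVal]⟩

lemma rel_smul_mem {S : Set (Datum → R)} {s : Datum → R} (hs : s ∈ S) {n j : ℕ} (hj : 1 ≤ j)
    (hjn : j < n) : (fun x => x.rel j x.k • s x) ∈ structSpan S n j :=
  Submodule.subset_span ⟨{j}, 0, ⟨by simp [hj, hjn], by simp, by simp, by simp⟩, s, hs, by
    ext1 x; simp [structVal]⟩

/-- Summing over the directions closes the free factors `b`, together with the new factor of order
`j`, into a single aggregate `j ::ₘ b`. The family `s` must not depend on the direction. -/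
lemma sum_rel_smul_mem {S : Set (Datum → R)} (hS : ∀ s ∈ S, ∀ x i, s (Datum.turn x i) = s x)
    {n d j : ℕ} (hj : 1 ≤ j) (hjn : j < n) {f : Datum → R} (hf : f ∈ structSpan S n d) :
    (fun x => ∑ i, x.rel j i • f (x.turn i)) ∈ structSpan S n (j + d) := by
  induction hf using Submodule.span_induction with
  | mem f hf =>
    obtain ⟨b, T, hb, s, hs, rfl⟩ := hf
    refine Submodule.subset_span ⟨0, (j ::ₘ b) ::ₘ T, ⟨by simp, ?_, ?_, ?_⟩, s, hs, ?_⟩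
    · intro t ht
      rcases Multiset.mem_cons.1 ht with rfl | ht
      · exact Multiset.cons_ne_zero
      · exact hb.2.1 t ht
    · intro t ht
      rcases Multiset.mem_cons.1 ht with rfl | ht
      · intro i hi
        rcases Multiset.mem_cons.1 hi with rfl | hi
        · exact ⟨hj, hjn⟩
        · exact hb.1 i hi
      · exact hb.2.2.1 t ht
    · simp only [Multiset.sum_zero, Multiset.map_cons, Multiset.sum_cons, ← hb.2.2.2]
      omega
    · ext1 x
      simp only [hS s hs, structVal, Multiset.map_cons, Multiset.prod_cons, Multiset.map_zero,
        Multiset.prod_zero, one_mul, Finset.sum_mul, Finset.sum_smul, smul_smul]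
      refine Finset.sum_congr rfl fun i _ => ?_
      congr 1
      exact (mul_assoc _ _ _).symm
  | zero =>
    convert! (structSpan S n (j + d)).zero_mem using 1
    ext1 x
    simp
  | add f g _ _ hf hg =>
    convert! (structSpan S n (j + d)).add_mem hf hg using 1
    ext1 x
    simp [smul_add, Finset.sum_add_distrib]
  | smul c f _ hf =>
    convert! (structSpan S n (j + d)).smul_mem c hf using 1
    ext1 x
    simp [Finset.smul_sum, smul_comm c]

/-- The coefficients `F d`, `d ≤ n`, lie in the spans of structures up to a correction `c` of the
coefficient of order `n`. -/
def Tracked (n : ℕ) (S : ℕ → Set (Datum → R)) (c : Datum → R) (F : ℕ → Datum → R) : Prop :=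
  ∀ d ≤ n, F d - (if d = n then c else 0) ∈ structSpan (S d) n d

lemma Tracked.mem {n d : ℕ} {S : ℕ → Set (Datum → R)} {c : Datum → R} {F : ℕ → Datum → R}
    (h : Tracked n S c F) (hd : d < n) : F d ∈ structSpan (S d) n d := by
  simpa [hd.ne] using h d hd.le

lemma Tracked.mem_top {n : ℕ} {S : ℕ → Set (Datum → R)} {c : Datum → R} {F : ℕ → Datum → R}
    (h : Tracked n S c F) : F n - c ∈ structSpan (S n) n n := by
  simpa using h n le_rfl

/-- In a Cauchy product up to order `n`, a factor of order `n` can only meet a factor of order `0`,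
so the correction obeys the Leibniz rule. -/
lemma Tracked.conv {n : ℕ} (hn : 1 ≤ n) {S S' S'' : ℕ → Set (Datum → R)} {c c' : Datum → R}
    {F G : ℕ → Datum → R} (hF : Tracked n S c F) (hG : Tracked n S' c' G)
    (hS : ∀ a b, ∀ s ∈ S a, ∀ s' ∈ S' b, s * s' ∈ S'' (a + b)) :
    Tracked n S'' (c * G 0 + F 0 * c')
      (fun d => ∑ a ∈ Finset.range (d + 1), F a * G (d - a)) := by
  intro d hd
  have key : ∀ a ≤ d, F a * G (d - a) - ((if a = n then c * G 0 else 0)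
      + if d - a = n then F 0 * c' else 0) ∈ structSpan (S'' d) n d := by
    intro a ha
    have had : a + (d - a) = d := by omega
    by_cases h1 : a = n
    · have h2 : d - a = 0 := by omega
      have h3 : ¬ (0 = n) := by omega
      rw [h2, if_pos h1, if_neg h3, add_zero]
      have := structSpan_mul (hS a 0) (hF a (by omega)) (hG.mem (d := 0) (by omega))
      rw [if_pos h1, sub_mul] at this
      obtain rfl : d = a := by omega
      exact this
    · by_cases h2 : d - a = n
      · have h3 : a = 0 := by omega
        subst h3
        have := structSpan_mul (hS 0 _) (hF.mem (d := 0) (by omega)) (hG (d - 0) (by omega))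
        rw [if_pos h2, mul_sub] at this
        rw [if_neg h1, if_pos h2, zero_add]
        rwa [had] at this
      · have := structSpan_mul (hS a _) (hF.mem (d := a) (by omega))
          (hG.mem (d := d - a) (by omega))
        rw [if_neg h1, if_neg h2, add_zero, sub_zero]
        rwa [had] at this
  have := Submodule.sum_mem _ fun a (ha : a ∈ Finset.range (d + 1)) =>
    key a (Nat.lt_succ_iff.1 (Finset.mem_range.1 ha))
  rw [Finset.sum_sub_distrib, Finset.sum_add_distrib] at this
  convert! this using 2
  -- Reflection `a ↦ d - a` brings both corrections to the same index.
  have e2 : ∑ a ∈ Finset.range (d + 1), (if d - a = n then F 0 * c' else 0)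
      = ∑ a ∈ Finset.range (d + 1), (if a = n then F 0 * c' else 0) := by
    rw [← Finset.sum_range_reflect]
    refine Finset.sum_congr rfl fun a ha => ?_
    have := Finset.mem_range.1 ha
    congr 2
    omega
  rw [e2, Finset.sum_ite_eq', Finset.sum_ite_eq']
  by_cases h : d = n
  · subst h; simp
  · have : ¬ n < d + 1 := by omega
    simp [h, this]

/-- As `F 0 = 0`, the right-hand side involves only earlier values of `G`, and the correction of `F`
meets only `G 0 = H 0`. Closure under products is required only for `a ≥ 1`; for ratios it would
fail at `a = 0`, where the number of factors grows but the order does not. -/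
lemma Tracked.recurrence {n : ℕ} (hn : 1 ≤ n) {S S' : ℕ → Set (Datum → R)} {c c' : Datum → R}
    {F G H : ℕ → Datum → R} (r : ℕ → ℝ) (hF : Tracked n S c F) (hF0 : F 0 = 0)
    (hH : Tracked n S' c' H)
    (hG : ∀ d ≤ n, G d = H d + r d • ∑ a ∈ Finset.range (d + 1), F a * G (d - a))
    (hS : ∀ a b, 1 ≤ a → ∀ s ∈ S a, ∀ s' ∈ S' b, s * s' ∈ S' (a + b)) :
    Tracked n S' (c' + r n • (c * H 0)) G := by
  have hG0 : G 0 = H 0 := by simpa [hF0] using hG 0 (by omega)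
  intro d
  induction d using Nat.strong_induction_on with
  | _ d ih =>
    intro hd
    have key : ∀ a ≤ d, F a * G (d - a) - (if a = n then c * H 0 else 0)
        ∈ structSpan (S' d) n d := by
      intro a ha
      by_cases h0 : a = 0
      · subst h0
        have : ¬ (0 = n) := by omega
        simp [hF0, this]
      have hGm : G (d - a) ∈ structSpan (S' (d - a)) n (d - a) := by
        have := ih (d - a) (by omega) (by omega)
        rwa [if_neg (by omega), sub_zero] at this
      have := structSpan_mul (hS a (d - a) (by omega)) (hF a (by omega)) hGm
      rw [show a + (d - a) = d by omega] at this
      by_cases h1 : a = n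
      · rw [if_pos h1, sub_mul] at this
        rw [if_pos h1, ← hG0]
        have h2 : d - a = 0 := by omega
        rwa [h2] at this ⊢
      · rw [if_neg h1, sub_zero] at this
        rwa [if_neg h1, sub_zero]
    have h1 := Submodule.sum_mem _ fun a (ha : a ∈ Finset.range (d + 1)) =>
      key a (Nat.lt_succ_iff.1 (Finset.mem_range.1 ha))
    rw [Finset.sum_sub_distrib] at h1
    have h2 := Submodule.add_mem _ (hH d hd) (Submodule.smul_mem _ (r d) h1)
    convert! h2 using 1
    rw [hG d hd, smul_sub, Finset.sum_ite_eq']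
    by_cases h : d = n
    · subst h; simp; abel
    · have : ¬ n < d + 1 := by omega
      simp [h, this]

end span

/-! ### Polynomials in `X` and products of chi-squared ratios -/

open Polynomial in
/-- Constant families of polynomials of degree at most `p`. -/
def polySet (p : ℕ) : Set (Datum → ℝ[X]) := {s | ∃ P : ℝ[X], P.natDegree ≤ p ∧ s = fun _ => P}

lemma polySet_mul {a b : ℕ} : ∀ s ∈ polySet a, ∀ s' ∈ polySet b, s * s' ∈ polySet (a + b) := by
  rintro _ ⟨P, hP, rfl⟩ _ ⟨Q, hQ, rfl⟩
  exact ⟨P * Q, Polynomial.natDegree_mul_le.trans (add_le_add hP hQ), rfl⟩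

lemma polySet_mono {a b : ℕ} (h : a ≤ b) : polySet a ⊆ polySet b :=
  fun _ ⟨P, hP, e⟩ => ⟨P, hP.trans h, e⟩

lemma polySet_turn {p : ℕ} : ∀ s ∈ polySet p, ∀ x i, s (Datum.turn x i) = s x := by
  rintro _ ⟨P, hP, rfl⟩ x i
  rfl

/-- The chi-squared ratio `F_{v + 2j} / F_v`. -/
def rat (j : ℕ) (x : Datum) : ℝ :=
  chiSqCDF (x.v + 2 * j) (x.ρ / x.lt) / chiSqCDF x.v (x.ρ / x.lt)

/-- Products of at most `N` chi-squared ratios of total index at most `K`. -/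
def ratSet (N K : ℕ) : Set (Datum → ℝ) :=
  {s | ∃ κ : Multiset ℕ, κ.card ≤ N ∧ κ.sum ≤ K ∧ s = fun x => (κ.map fun j => rat j x).prod}

lemma ratSet_mul {N K N' K' N'' K'' : ℕ} (hN : N + N' ≤ N'') (hK : K + K' ≤ K'') :
    ∀ s ∈ ratSet N K, ∀ s' ∈ ratSet N' K', s * s' ∈ ratSet N'' K'' := by
  rintro _ ⟨κ, h1, h2, rfl⟩ _ ⟨κ', h1', h2', rfl⟩
  refine ⟨κ + κ', ?_, ?_, ?_⟩
  · rw [Multiset.card_add]; omega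
  · rw [Multiset.sum_add]; omega
  · ext x; simp

lemma ratSet_mono {N K N' K' : ℕ} (hN : N ≤ N') (hK : K ≤ K') : ratSet N K ⊆ ratSet N' K' :=
  fun _ ⟨κ, h1, h2, e⟩ => ⟨κ, h1.trans hN, h2.trans hK, e⟩

lemma rat_mem (j : ℕ) : rat j ∈ ratSet 1 j := ⟨{j}, by simp, by simp, by ext; simp⟩

lemma Datum.cdf_pos (x : Datum) : 0 < chiSqCDF x.v (x.ρ / x.lt) :=
  chiSqCDF_pos (Fin.pos x.k) (div_pos x.hρ x.hlt)

lemma rat_zero (x : Datum) : rat 0 x = 1 := div_self x.cdf_pos.ne'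

/-- Replacement of `X ^ j` by `F_{v + 2j} / F_v`. -/
def ellN (P : Datum → Polynomial ℝ) (x : Datum) : ℝ :=
  ell x.v (x.ρ / x.lt) (P x) / chiSqCDF x.v (x.ρ / x.lt)

lemma ellN_eq (P : Datum → Polynomial ℝ) (x : Datum) :
    ellN P x = (P x).sum fun j a => a * rat j x := by
  simp only [ellN, ell_apply, rat, Polynomial.sum_def, Finset.sum_div, mul_div_assoc]

lemma ellN_add (P Q : Datum → Polynomial ℝ) : ellN (P + Q) = ellN P + ellN Q := by
  ext x; simp [ellN, add_div]

lemma ellN_sub (P Q : Datum → Polynomial ℝ) : ellN (P - Q) = ellN P - ellN Q := by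
  ext x; simp [ellN, sub_div]

lemma ellN_smul (f : Datum → ℝ) (P : Datum → Polynomial ℝ) :
    ellN (fun x => f x • P x) = fun x => f x * ellN P x := by
  ext x; simp [ellN, mul_div_assoc]

lemma ellN_mem {n d p : ℕ} {P : Datum → Polynomial ℝ} (hP : P ∈ structSpan (polySet p) n d) :
    ellN P ∈ structSpan (ratSet 1 p) n d := by
  induction hP using Submodule.span_induction with
  | mem f hf =>
    obtain ⟨b, T, hb, _, ⟨P, hP, rfl⟩, rfl⟩ := hf
    rw [ellN_smul]
    have : (fun x => structVal b T x * ellN (fun _ => P) x)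
        = ∑ j ∈ P.support, P.coeff j • fun x => structVal b T x • rat j x := by
      ext x
      rw [ellN_eq, Polynomial.sum_def, Finset.mul_sum, Finset.sum_apply]
      refine Finset.sum_congr rfl fun j _ => ?_
      simp only [Pi.smul_apply, smul_eq_mul]
      ring
    rw [this]
    refine Submodule.sum_mem _ fun j hj => Submodule.smul_mem _ _ (Submodule.subset_span ?_)
    exact ⟨b, T, hb, rat j, ratSet_mono le_rfl
      ((Polynomial.le_natDegree_of_mem_supp j hj).trans hP) (rat_mem j), rfl⟩
  | zero =>
    convert! Submodule.zero_mem _ using 1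
    ext x; simp [ellN]
  | add f g _ _ hf hg => rw [ellN_add]; exact Submodule.add_mem _ hf hg
  | smul c f _ hf =>
    have : ellN (c • f) = c • ellN f := ellN_smul (fun _ => c) f
    rw [this]; exact Submodule.smul_mem _ _ hf

lemma Tracked.ellN {n : ℕ} {p : ℕ → ℕ} {c : Datum → Polynomial ℝ}
    {F : ℕ → Datum → Polynomial ℝ} (h : Tracked n (fun d => polySet (p d)) c F) :
    Tracked n (fun d => ratSet 1 (p d)) (TruncatedSpectrum.ellN c)
      (fun d => TruncatedSpectrum.ellN (F d)) := by
  intro d hd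
  have := ellN_mem (h d hd)
  rw [ellN_sub] at this
  convert! this using 2
  split_ifs
  · rfl
  · ext x; simp [TruncatedSpectrum.ellN]

section span

variable {R : Type*} [CommRing R] [Algebra ℝ R]

lemma Tracked.const_mul {n : ℕ} {S S' : ℕ → Set (Datum → R)} {c : Datum → R}
    {F : ℕ → Datum → R} (hF : Tracked n S c F) {s : Datum → R}
    (hS : ∀ d, ∀ s' ∈ S d, s * s' ∈ S' d) : Tracked n S' (s * c) (fun d => s * F d) := by
  intro d hd
  have := structSpan_mul (S := {s}) (by rintro _ rfl; exact hS d)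
    (mem_structSpan_zero (Set.mem_singleton s) n) (hF d hd)
  rw [mul_sub, zero_add] at this
  convert! this using 2
  split_ifs <;> simp

lemma Tracked.mono {n : ℕ} {S S' : ℕ → Set (Datum → R)} {c : Datum → R}
    {F : ℕ → Datum → R} (hF : Tracked n S c F) (hS : ∀ d ≤ n, S d ⊆ S' d) :
    Tracked n S' c F := fun d hd => structSpan_mono (hS d hd) n d (hF d hd)

end span

lemma coeff_mul_range {R : Type*} [CommRing R] (f g : PowerSeries R) (d : ℕ) :
    PowerSeries.coeff d (f * g) =
      ∑ a ∈ Finset.range (d + 1), PowerSeries.coeff a f * PowerSeries.coeff (d - a) g := by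
  rw [PowerSeries.coeff_mul, Finset.Nat.sum_antidiagonal_eq_sum_range_succ_mk]

lemma coeff_X_mul_derivative {R : Type*} [CommRing R] (f : PowerSeries R) (d : ℕ) :
    PowerSeries.coeff d (PowerSeries.X * PowerSeries.derivative R f)
      = PowerSeries.coeff d f * d := by
  cases d with
  | zero => simp
  | succ d => rw [PowerSeries.coeff_succ_X_mul, PowerSeries.coeff_derivative]; push_cast; ring

/-! ### Tracking the series, and cancellation by the Jacobian -/

section coefficients

variable (n : ℕ)

/-- Coefficients of `1 / (1 + δ_k (1 - X))`. -/
def invCoef (d : ℕ) (x : Datum) : Polynomial ℝ := PowerSeries.coeff d (invP n x.lt x.lam x.k)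

/-- Coefficients of `∏ i, (1 + δ_i (1 - X)) ^ (-1/2)`. -/
def rootCoef (d : ℕ) (x : Datum) : Polynomial ℝ := PowerSeries.coeff d (rootP n x.lt x.lam)

/-- Coefficients of `δ_k (1 - X)`. -/
def pertCoef (d : ℕ) (x : Datum) : Polynomial ℝ :=
  PowerSeries.coeff d (deltaP n x.lt x.lam x.k * uP)

/-- Coefficients of the logarithmic Euler derivative of `∏ i, (1 + δ_i (1 - X))`. -/
def eulerCoef (d : ℕ) (x : Datum) : Polynomial ℝ :=
  ∑ i, PowerSeries.coeff d (PowerSeries.X * PowerSeries.derivative _ (deltaP n x.lt x.lam i) * uP *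
    invP n x.lt x.lam i)

lemma coeff_deltaP (x : Datum) (i : Fin x.v) (d : ℕ) :
    PowerSeries.coeff d (deltaP n x.lt x.lam i)
      = Polynomial.C (if 1 ≤ d ∧ d ≤ n then x.rel d i else 0) := by
  rw [deltaP, PowerSeries.coeff_map, delta, PowerSeries.coeff_mk]
  rfl

lemma pertCoef_eq (d : ℕ) (x : Datum) :
    pertCoef n d x = (if 1 ≤ d ∧ d ≤ n then x.rel d x.k else 0) • (1 - Polynomial.X) := by
  rw [pertCoef, uP, PowerSeries.coeff_mul_C, coeff_deltaP, Polynomial.C_mul']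

lemma one_sub_X_mem {p : ℕ} (hp : 1 ≤ p) :
    (fun _ => 1 - Polynomial.X : Datum → Polynomial ℝ) ∈ polySet p := by
  refine ⟨_, ?_, rfl⟩
  refine (Polynomial.natDegree_sub_le _ _).trans ?_
  simpa using hp

lemma tracked_pertCoef (hn : 1 ≤ n) :
    Tracked n polySet (fun x => x.rel n x.k • (1 - Polynomial.X)) (pertCoef n) := by
  intro d hd
  by_cases h0 : d = 0
  · have e : pertCoef n d = 0 := by ext1 x; simp [pertCoef_eq, h0]
    rw [e, if_neg (by omega), sub_zero]; exact Submodule.zero_mem _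
  · have h1 : 1 ≤ d := by omega
    have e : pertCoef n d = fun x => x.rel d x.k • (1 - Polynomial.X) := by
      ext1 x; rw [pertCoef_eq, if_pos ⟨h1, hd⟩]
    by_cases h : d = n
    · rw [e, if_pos h, h, sub_self]; exact Submodule.zero_mem _
    · rw [e, if_neg h, sub_zero]
      exact rel_smul_mem (one_sub_X_mem h1) h1 (by omega)

lemma tracked_one (hn : 1 ≤ n) :
    Tracked n polySet 0 (fun d _ => if d = 0 then 1 else 0) := by
  intro d hd
  by_cases h0 : d = 0
  · subst h0
    rw [if_neg (by omega), sub_zero]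
    have h1 : (fun _ => 1 : Datum → Polynomial ℝ) ∈ polySet 0 := ⟨1, by simp, rfl⟩
    exact mem_structSpan_zero h1 n
  · convert! Submodule.zero_mem _ using 1
    ext1 x
    simp [h0]

lemma invCoef_rec (d : ℕ) : invCoef n d = (fun _ => if d = 0 then 1 else 0) +
    (-1 : ℝ) • ∑ a ∈ Finset.range (d + 1), pertCoef n a * invCoef n (d - a) := by
  ext1 x
  have h := congrArg (PowerSeries.coeff d) (mul_invP n x.lt x.lam x.k)
  rw [add_mul, one_mul, map_add, coeff_mul_range, PowerSeries.coeff_one] at h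
  simp only [Pi.add_apply, Pi.smul_apply, Finset.sum_apply, Pi.mul_apply]
  rw [neg_smul, one_smul, ← sub_eq_add_neg, ← h]
  simp only [invCoef, pertCoef]
  ring

lemma invCoef_zero : invCoef n 0 = 1 := by
  rw [invCoef_rec]; ext1 x; simp [pertCoef_eq]

lemma tracked_invCoef (hn : 1 ≤ n) :
    Tracked n polySet (fun x => -(x.rel n x.k • (1 - Polynomial.X))) (invCoef n) := by
  have := Tracked.recurrence hn (fun _ => -1) (tracked_pertCoef n hn)
    (by ext1 x; simp [pertCoef_eq]) (tracked_one n hn) (fun d _ => invCoef_rec n d)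
    (fun a b _ => polySet_mul)
  convert! this using 1
  ext1 x
  simp

lemma eulerCoef_eq (d : ℕ) (x : Datum) : eulerCoef n d x =
    ∑ a ∈ Finset.range (d + 1), ∑ i, (if 1 ≤ a ∧ a ≤ n then (a : ℝ) * x.rel a i else 0) •
      ((1 - Polynomial.X) * invCoef n (d - a) (x.turn i)) := by
  rw [Finset.sum_comm, eulerCoef]
  refine Finset.sum_congr rfl fun i _ => ?_
  rw [mul_assoc, coeff_mul_range]
  refine Finset.sum_congr rfl fun a _ => ?_
  rw [coeff_X_mul_derivative, uP, PowerSeries.coeff_C_mul, coeff_deltaP,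
    ← Polynomial.C_eq_natCast, ← Polynomial.C_mul, Polynomial.C_mul']
  congr 1
  split_ifs <;> ring

lemma eulerCoef_zero : eulerCoef n 0 = 0 := by
  ext1 x; simp [eulerCoef_eq]

/-- The sum over directions is where aggregates arise. The Euler derivative multiplies order `a` by
`a` without shifting it, so orders are preserved, and the correction acquires the factor `n`. -/
lemma tracked_eulerCoef (hn : 1 ≤ n) :
    Tracked n polySet (fun x => (n * ∑ i, x.rel n i) • (1 - Polynomial.X)) (eulerCoef n) := by
  intro d hd
  have e : eulerCoef n d - (if d = n then
        fun x : Datum => (n * ∑ i, x.rel n i) • (1 - Polynomial.X : Polynomial ℝ) else 0) =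
      ∑ a ∈ Finset.range (d + 1), ((fun x : Datum => ∑ i,
          (if 1 ≤ a ∧ a ≤ n then (a : ℝ) * x.rel a i else 0) •
          ((1 - Polynomial.X) * invCoef n (d - a) (x.turn i))) - if a = n then
        fun x : Datum => (n * ∑ i, x.rel n i) • (1 - Polynomial.X : Polynomial ℝ) else 0) := by
    rw [Finset.sum_sub_distrib, Finset.sum_ite_eq']
    congr 1
    · ext1 x; rw [eulerCoef_eq, Finset.sum_apply]
    · by_cases h : d = n
      · simp [h]
      · have : ¬ n < d + 1 := by omega
        simp [h, this]
  rw [e]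
  refine Submodule.sum_mem _ fun a ha => ?_
  have ha : a ≤ d := Nat.lt_succ_iff.1 (Finset.mem_range.1 ha)
  by_cases h0 : a = 0
  · convert! Submodule.zero_mem _ using 1
    ext1 x
    have : ¬ 0 = n := by omega
    simp [h0, this]
  have h1 : 1 ≤ a ∧ a ≤ n := ⟨by omega, by omega⟩
  simp only [if_pos h1]
  by_cases h : a = n
  · rw [if_pos h]
    convert! Submodule.zero_mem _ using 1
    have : d - a = 0 := by omega
    ext1 x
    rw [this, h, invCoef_zero]
    simp [← Finset.sum_smul, Finset.mul_sum]
  · rw [if_neg h, sub_zero]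
    -- The degree is at most `1 + (d - a) ≤ d`, because `a ≥ 1`.
    have hq : (fun _ => 1 - Polynomial.X) * invCoef n (d - a)
        ∈ structSpan (polySet d) n (0 + (d - a)) := by
      refine structSpan_mul (S := polySet 1) (S' := polySet (d - a)) ?_
        (mem_structSpan_zero (one_sub_X_mem le_rfl) n)
        ((tracked_invCoef n hn).mem (by omega))
      exact fun s hs s' hs' => polySet_mono (by omega) (polySet_mul s hs s' hs')
    have := Submodule.smul_mem _ (a : ℝ)
      (sum_rel_smul_mem polySet_turn h1.1 (lt_of_le_of_ne h1.2 h) hq)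
    rw [zero_add, show a + (d - a) = d by omega] at this
    convert! this using 1
    ext1 x
    simp only [Pi.smul_apply, Finset.smul_sum, smul_smul, Pi.mul_apply]

lemma rootCoef_rec (d : ℕ) : rootCoef n d = (fun _ => if d = 0 then 1 else 0) +
    (-(1 / (2 * (d : ℝ)))) • ∑ a ∈ Finset.range (d + 1), eulerCoef n a * rootCoef n (d - a) := by
  ext1 x
  -- The factor `1 / (2d)` is harmless at `d = 0`, since `eulerCoef n 0` vanishes.
  by_cases h0 : d = 0
  · subst h0
    simp [eulerCoef_zero, rootCoef, rootP, odeCoef_zero]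
  have h := congrArg (PowerSeries.coeff d)
    (congrArg (PowerSeries.X * ·) (derivative_rootP n x.lt x.lam))
  have e : PowerSeries.X * (rootP n x.lt x.lam * logDerivP n x.lt x.lam) =
      PowerSeries.C (Polynomial.C (-(1 / 2))) * ((∑ i, PowerSeries.X *
        PowerSeries.derivative _ (deltaP n x.lt x.lam i) * uP * invP n x.lt x.lam i) *
          rootP n x.lt x.lam) := by
    rw [logDerivP]
    simp only [mul_assoc, ← Finset.mul_sum]
    ring
  beta_reduce at h
  rw [e, coeff_X_mul_derivative, PowerSeries.coeff_C_mul, coeff_mul_range] at h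
  have h2 : rootCoef n d x * (d : Polynomial ℝ) = Polynomial.C (-(1 / 2)) *
      ∑ a ∈ Finset.range (d + 1), eulerCoef n a x * rootCoef n (d - a) x := by
    rw [rootCoef, h]
    congr 1
    refine Finset.sum_congr rfl fun a _ => ?_
    rw [map_sum]
    rfl
  have hd : (d : ℝ) ≠ 0 := by exact_mod_cast h0
  simp only [Pi.add_apply, Pi.smul_apply, Finset.sum_apply, Pi.mul_apply, if_neg h0, zero_add]
  rw [← Polynomial.C_eq_natCast, mul_comm, Polynomial.C_mul', Polynomial.C_mul'] at h2
  have h3 := congrArg (fun P => (d : ℝ)⁻¹ • P) h2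
  simp only [smul_smul, inv_mul_cancel₀ hd, one_smul] at h3
  rw [h3]
  congr 1
  field_simp

lemma rootCoef_zero : rootCoef n 0 = 1 := by
  ext1 x; simp [rootCoef, rootP, odeCoef_zero]

lemma tracked_rootCoef (hn : 1 ≤ n) :
    Tracked n polySet (fun x => (-(1 / 2) * ∑ i, x.rel n i) • (1 - Polynomial.X))
      (rootCoef n) := by
  have := Tracked.recurrence hn (fun d => -(1 / (2 * (d : ℝ)))) (tracked_eulerCoef n hn)
    (eulerCoef_zero n) (tracked_one n hn) (fun d _ => rootCoef_rec n d)
    (fun a b _ => polySet_mul)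
  convert! this using 1
  ext1 x
  have hn0 : (n : ℝ) ≠ 0 := by positivity
  simp only [Pi.add_apply, Pi.zero_apply, zero_add, Pi.smul_apply, Pi.mul_apply, if_true, mul_one,
    smul_smul]
  congr 1
  field_simp

/-- Coefficients of the formal counterpart of `α_k`. -/
def numCoef (d : ℕ) (x : Datum) : Polynomial ℝ :=
  PowerSeries.coeff d (PowerSeries.C Polynomial.X * rootP n x.lt x.lam * invP n x.lt x.lam x.k)

lemma numCoef_eq (d : ℕ) : numCoef n d = (fun _ => Polynomial.X) *
    ∑ a ∈ Finset.range (d + 1), rootCoef n a * invCoef n (d - a) := by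
  ext1 x
  rw [numCoef, mul_assoc, PowerSeries.coeff_C_mul, coeff_mul_range]
  simp [rootCoef, invCoef]

lemma tracked_numCoef (hn : 1 ≤ n) :
    Tracked n (fun d => polySet (d + 1))
      (fun x => (-(1 / 2) * ∑ i, x.rel n i - x.rel n x.k) •
        (Polynomial.X * (1 - Polynomial.X))) (numCoef n) := by
  have h := (Tracked.conv hn (tracked_rootCoef n hn) (tracked_invCoef n hn)
    (S'' := polySet) (fun a b => polySet_mul)).const_mul (s := fun _ => Polynomial.X)
    (S' := fun d => polySet (d + 1)) (fun d s hs => by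
      rw [add_comm]
      exact polySet_mul (a := 1) _ ⟨_, Polynomial.natDegree_X_le, rfl⟩ _ hs)
  convert! h using 1
  · ext1 x
    simp only [Pi.mul_apply, Pi.add_apply, invCoef_zero, rootCoef_zero, mul_one,
      one_mul, sub_smul]
    simp only [mul_add, mul_neg, mul_smul_comm, sub_eq_add_neg]
  · ext1 d; exact numCoef_eq n d

/-- Normalized Taylor coefficients of `α`. -/
def alphaCoef (d : ℕ) : Datum → ℝ := ellN (rootCoef n d)

/-- Normalized Taylor coefficients of `α_k`. -/
def alphaKCoef (d : ℕ) : Datum → ℝ := ellN (numCoef n d)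

lemma ellN_X_pow (j : ℕ) (x : Datum) : ellN (fun _ => Polynomial.X ^ j) x = rat j x := by
  rw [ellN, ell_X_pow, rat]

lemma ellN_one (x : Datum) : ellN (fun _ => 1) x = 1 := by
  have := ellN_X_pow 0 x
  rwa [pow_zero, rat_zero] at this

lemma ellN_one_sub_X (x : Datum) : ellN (fun _ => 1 - Polynomial.X) x = 1 - rat 1 x := by
  have : (fun _ => 1 - Polynomial.X : Datum → Polynomial ℝ)
      = (fun _ => 1) - fun _ => Polynomial.X ^ 1 := by ext1; simp
  rw [this, ellN_sub, Pi.sub_apply, ellN_one, ellN_X_pow]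

lemma ellN_X_mul_one_sub_X (x : Datum) :
    ellN (fun _ => Polynomial.X * (1 - Polynomial.X)) x = rat 1 x - rat 2 x := by
  have : (fun _ => Polynomial.X * (1 - Polynomial.X) : Datum → Polynomial ℝ)
      = (fun _ => Polynomial.X ^ 1) - fun _ => Polynomial.X ^ 2 := by
    ext1; simp only [Pi.sub_apply]; ring
  rw [this, ellN_sub, Pi.sub_apply, ellN_X_pow, ellN_X_pow]

lemma tracked_alphaCoef (hn : 1 ≤ n) : Tracked n (fun d => ratSet 1 d)
    (fun x => -(1 / 2) * (∑ i, x.rel n i) * (1 - rat 1 x)) (alphaCoef n) := by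
  have := Tracked.ellN (p := fun d => d) (tracked_rootCoef n hn)
  convert! this using 1
  ext1 x
  rw [ellN_smul]
  beta_reduce
  rw [ellN_one_sub_X]

lemma tracked_alphaKCoef (hn : 1 ≤ n) : Tracked n (fun d => ratSet 1 (d + 1))
    (fun x => (-(1 / 2) * ∑ i, x.rel n i - x.rel n x.k) * (rat 1 x - rat 2 x))
    (alphaKCoef n) := by
  have := Tracked.ellN (p := fun d => d + 1) (tracked_numCoef n hn)
  convert! this using 1
  ext1 x
  rw [ellN_smul]
  beta_reduce
  rw [ellN_X_mul_one_sub_X]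

lemma alphaCoef_zero (x : Datum) : alphaCoef n 0 x = 1 := by
  rw [alphaCoef, rootCoef_zero]
  exact ellN_one x

lemma alphaKCoef_zero (x : Datum) : alphaKCoef n 0 x = rat 1 x := by
  have : numCoef n 0 = fun _ => Polynomial.X ^ 1 := by
    ext1 x; simp [numCoef_eq, rootCoef_zero, invCoef_zero]
  rw [alphaKCoef, this, ellN_X_pow]

/-- Taylor coefficients of the ratio `R_k`. -/
def ratioC (d : ℕ) (x : Datum) : ℝ := ratioCoef n x.ρ x.lam d x.k

lemma sum_alphaCoef_mul_ratioC (d : ℕ) (x : Datum) :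
    ∑ a ∈ Finset.range (d + 1), alphaCoef n a x * ratioC n (d - a) x = alphaKCoef n d x := by
  have : NeZero x.v := ⟨(Fin.pos x.k).ne'⟩
  have h := congrArg (PowerSeries.coeff d) (taylorSeries_ratioR_mul (n := n) x.hρ x.hlt x.h0 x.k)
  rw [mul_comm, coeff_mul_range] at h
  simp only [ellS, PowerSeries.coeff_mk, coeff_taylorSeries] at h
  rw [alphaKCoef, ellN, numCoef, ← h, Finset.sum_div]
  refine Finset.sum_congr rfl fun a _ => ?_
  rw [alphaCoef, ellN, ratioC, ratioCoef, rootCoef]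
  ring

/-- This is the division of series `α R_k = α_k`, normalised so that `α` has leading coefficient
`1`. Removing the term `a = 0` isolates the new coefficient. -/
lemma ratioC_rec (d : ℕ) : ratioC n d = alphaKCoef n d + (-1 : ℝ) •
    ∑ a ∈ Finset.range (d + 1), (if a = 0 then 0 else alphaCoef n a) * ratioC n (d - a) := by
  ext x
  have h := sum_alphaCoef_mul_ratioC n d x
  simp only [Pi.add_apply, Pi.smul_apply, Finset.sum_apply, Pi.mul_apply, smul_eq_mul]
  rw [← h, Finset.sum_range_succ', Finset.sum_range_succ', alphaCoef_zero]
  simp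

lemma ratioC_zero (x : Datum) : ratioC n 0 x = rat 1 x := by
  rw [ratioC_rec]
  simp [alphaKCoef_zero]

/-- Each division step of order `a ≥ 1` adds one ratio factor and index at most `a`, so order `d`
has at most `d + 1` factors and total index at most `d + 1`. This is the origin of both bounds in
`admissible`. -/
lemma tracked_ratioC (hn : 1 ≤ n) : Tracked n (fun d => ratSet (d + 1) (d + 1))
    (fun x => (-(1 / 2) * ∑ i, x.rel n i - x.rel n x.k) * (rat 1 x - rat 2 x)
      + (1 / 2) * (∑ i, x.rel n i) * (1 - rat 1 x) * rat 1 x) (ratioC n) := by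
  have hF : Tracked n (fun d => ratSet 1 d)
      (fun x => -(1 / 2) * (∑ i, x.rel n i) * (1 - rat 1 x))
      (fun a => if a = 0 then 0 else alphaCoef n a) := by
    intro d hd
    by_cases h0 : d = 0
    · have : ¬ d = n := by omega
      simp only [if_pos h0, if_neg this, sub_zero]
      exact Submodule.zero_mem _
    · simp only [if_neg h0]
      exact tracked_alphaCoef n hn d hd
  have := Tracked.recurrence hn (fun _ => -1) hF (by simp)
    ((tracked_alphaKCoef n hn).mono (S' := fun d => ratSet (d + 1) (d + 1))
      fun d _ => ratSet_mono (by omega) le_rfl)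
    (fun d _ => ratioC_rec n d) (fun a b ha => ratSet_mul (by omega) (by omega))
  convert! this using 1
  ext1 x
  simp only [Pi.add_apply, Pi.smul_apply, Pi.mul_apply, smul_eq_mul, alphaKCoef_zero]
  ring

lemma tracked_rel (hn : 1 ≤ n) : Tracked n (fun _ => ratSet 0 0) (fun x => x.rel n x.k)
    (fun d x => x.rel d x.k) := by
  have h1 : (fun _ => 1 : Datum → ℝ) ∈ ratSet 0 0 := ⟨0, by simp, by simp, by ext; simp⟩
  intro d hd
  by_cases h : d = n
  · rw [if_pos h, h, sub_self]; exact Submodule.zero_mem _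
  · rw [if_neg h, sub_zero]
    by_cases h0 : d = 0
    · subst h0
      convert! mem_structSpan_zero h1 n using 1
      ext1 x
      change x.lam 0 x.k / x.lt = 1
      rw [x.h0, div_self x.hlt.ne']
    · simpa using rel_smul_mem h1 (show 1 ≤ d by omega) (show d < n by omega)

/-- The part of the source term not depending on `μ`, relative to `λ̃`. -/
def relSource (x : Datum) : ℝ := source n x.ρ x.lt x.lam 0 x.k / x.lt

/-- Write `r_j` for `rat j` and `Λ` for the sum of the relative perturbations of order `n`. The
correction in `λ_k R_k` collects to `(1/2) Λ (r_2 - r_1²) + r_2 · rel n k`, which is the relative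
form of `J λ^{(n)}`; the source therefore contains no `λ^{(n)}`. -/
lemma relSource_mem (hn : 1 ≤ n) : relSource n ∈ structSpan (ratSet (n + 1) (n + 1)) n n := by
  have h := (Tracked.conv hn (tracked_rel n hn) (tracked_ratioC n hn)
    (S'' := fun d => ratSet (d + 1) (d + 1))
    (fun a b => ratSet_mul (by omega) (by omega))).mem_top
  convert! Submodule.neg_mem _ h using 1
  ext1 x
  have hlt := x.hlt.ne'
  have e1 : orderEq n x.ρ x.lam 0 x.k =
      x.lt * ∑ a ∈ Finset.range (n + 1), x.rel a x.k * ratioC n (n - a) x := by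
    rw [orderEq, Pi.zero_apply, sub_zero, ← Finset.sum_range_reflect, Finset.mul_sum]
    refine Finset.sum_congr rfl fun a ha => ?_
    have : n - (n - a) = a := by have := Finset.mem_range.1 ha; omega
    simp only [Nat.add_sub_cancel, this, Datum.rel, ratioC]
    field_simp
  have e2 : ∑ j, jac x.v x.ρ x.lt x.k j * x.lam n j =
      x.lt * ((1 / 2) * (∑ i, x.rel n i) * (rat 2 x - rat 1 x ^ 2) + rat 2 x * x.rel n x.k) := by
    have : ∀ j, jac x.v x.ρ x.lt x.k j * x.lam n j =
        x.lt * ((1 / 2) * (rat 2 x - rat 1 x ^ 2)) * x.rel n j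
          + if x.k = j then x.lt * (rat 2 x * x.rel n j) else 0 := by
      intro j
      rw [jac, Datum.rel, rat, rat]
      split_ifs <;> field_simp <;> ring
    simp_rw [this]
    rw [Finset.sum_add_distrib, Finset.sum_ite_eq, ← Finset.mul_sum, if_pos (Finset.mem_univ _)]
    ring
  have e3 : x.rel 0 x.k = 1 := by rw [Datum.rel, x.h0, div_self hlt]
  rw [relSource, source, e1, e2]
  simp only [Pi.neg_apply, Pi.sub_apply, Finset.sum_apply, Pi.mul_apply, Pi.add_apply,
    ratioC_zero, e3]
  field_simp
  ring

end coefficients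

/-! ### Reading universal coefficients off the span -/

/-- A multiset of `N` numbers is listed by an antitone function on `Fin N`. -/
lemma exists_antitone_map_univ (N : ℕ) (M : Multiset ℕ) (hM : M.card = N) :
    ∃ κ : Fin N → ℕ, (∀ i j, i ≤ j → κ j ≤ κ i) ∧ Finset.univ.val.map κ = M := by
  subst hM
  have hlen : (M.sort (· ≥ ·)).length = M.card := Multiset.length_sort _
  refine ⟨fun i => (M.sort (· ≥ ·)).get (i.cast hlen.symm), ?_, ?_⟩
  · intro i j hij
    have hs : (M.sort (· ≥ ·)).Pairwise (· ≥ ·) := Multiset.pairwise_sort M (· ≥ ·)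
    rcases hij.eq_or_lt with rfl | h
    · exact le_rfl
    · exact List.pairwise_iff_get.1 hs _ _ h
  · have h2 : List.ofFn (fun i : Fin M.card => (M.sort (· ≥ ·)).get (i.cast hlen.symm))
        = M.sort (· ≥ ·) := by
      apply List.ext_get
      · simp
      · intro i h1 h2
        simp
    conv_rhs => rw [← Multiset.sort_eq M (· ≥ ·), ← h2]
    rw [Fin.univ_val_map]

lemma multiset_card_le_sum (b : Multiset ℕ) (h : ∀ j ∈ b, 1 ≤ j) : b.card ≤ b.sum := by
  simpa using Multiset.card_nsmul_le_sum h

/-- The structure with given nontrivial part. -/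
def IsStruct.toPert {n : ℕ} {b : Multiset ℕ} {T : Multiset (Multiset ℕ)}
    (h : IsStruct n n b T) : PertStructure n where
  a := n - (b.card + (T.map Multiset.card).sum)
  b := b
  T := T
  b_range := h.1
  T_ne := h.2.1
  T_range := h.2.2.1
  pertDim := h.2.2.2
  physDim := by
    -- All orders are at least `1`, so the number of factors is at most `n` and the subtraction
    -- defining `a` is not truncated.
    have h1 := multiset_card_le_sum b fun j hj => (h.1 j hj).1
    have h2 : (T.map Multiset.card).sum ≤ (T.map Multiset.sum).sum :=
      Multiset.sum_map_le_sum_map _ _ fun t ht =>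
        multiset_card_le_sum t fun j hj => (h.2.2.1 t ht j hj).1
    have h3 := h.2.2.2
    omega

lemma multiset_prod_map_div_const (s : Multiset ℕ) (f : ℕ → ℝ) (c : ℝ) :
    (s.map fun j => f j / c).prod = (s.map f).prod / c ^ s.card := by
  rw [Multiset.prod_map_div]
  simp

lemma structVal_eq (x : Datum) {n : ℕ} (m : PertStructure n) :
    structVal m.b m.T x = m.val x.lt x.lam x.k / x.lt ^ n := by
  have hlt := x.hlt.ne'
  have h1 : ∀ T : Multiset (Multiset ℕ),
      (T.map fun t => ∑ i, (t.map fun j => x.rel j i).prod).prod =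
      (T.map fun t => ∑ i, (t.map fun j => x.lam j i).prod).prod
        / x.lt ^ (T.map Multiset.card).sum := by
    intro T
    induction T using Multiset.induction_on with
    | empty => simp
    | cons t T ih =>
      simp only [Multiset.map_cons, Multiset.prod_cons, Multiset.sum_cons, ih, pow_add]
      simp only [Datum.rel, multiset_prod_map_div_const, ← Finset.sum_div]
      field_simp
  have h2 : x.lt ^ n = x.lt ^ (m.a + m.b.card + (m.T.map Multiset.card).sum) := by
    rw [m.physDim]
  rw [structVal, h1, PertStructure.val, h2]
  simp only [Datum.rel, multiset_prod_map_div_const, pow_add]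
  field_simp

lemma chiSqRatio_eq (x : Datum) {n : ℕ} (κ : Fin (n + 1) → ℕ) :
    chiSqRatio n x.v κ (x.ρ / x.lt) = ∏ j, rat (κ j) x := by
  simp [chiSqRatio, rat, Finset.prod_div_distrib]

/-- The generators are indexed by a finite set, so membership in the span yields real scalars valid
for all data, hence for all dimensions, at once. -/
lemma exists_coeff_of_mem_structSpan {n : ℕ} {f : Datum → ℝ}
    (hf : f ∈ structSpan (ratSet (n + 1) (n + 1)) n n) :
    ∃ γ : (Fin (n + 1) → ℕ) → PertStructure n → ℝ, ∀ x : Datum, f x =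
      (x.lt ^ n)⁻¹ * ∑ κ ∈ admissible n, cCoef γ x.lt x.lam x.k κ *
        chiSqRatio n x.v κ (x.ρ / x.lt) := by
  let g : (admissible n) × PertStructure n → Datum → ℝ := fun p x =>
    structVal p.2.b p.2.T x * chiSqRatio n x.v p.1 (x.ρ / x.lt)
  have hle : structSpan (ratSet (n + 1) (n + 1)) n n ≤ Submodule.span ℝ (Set.range g) := by
    refine Submodule.span_mono ?_
    rintro _ ⟨b, T, hb, _, ⟨M, hM1, hM2, rfl⟩, rfl⟩
    -- Padding with zeros reaches exactly `n + 1` factors and changes nothing, because `rat 0 = 1`.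
    obtain ⟨κ, hκ, hκM⟩ := exists_antitone_map_univ (n + 1)
      (M + Multiset.replicate (n + 1 - M.card) 0) (by simp; omega)
    have hsum : ∑ j, κ j = M.sum := by
      rw [Finset.sum_eq_multiset_sum, hκM]; simp
    have hmem : κ ∈ admissible n := by
      simp only [admissible, Finset.mem_filter, Fintype.mem_piFinset, Finset.mem_range]
      refine ⟨fun j => ?_, hκ, by omega⟩
      have := Finset.single_le_sum (f := κ) (fun _ _ => Nat.zero_le _) (Finset.mem_univ j)
      omega
    refine ⟨(⟨κ, hmem⟩, hb.toPert), ?_⟩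
    ext x
    have hprod : ∏ j, rat (κ j) x = (M.map fun j => rat j x).prod := by
      have : ∏ j, rat (κ j) x = ((Finset.univ.val.map κ).map fun j => rat j x).prod := by
        rw [Multiset.map_map]; rfl
      rw [this, hκM]
      simp [rat_zero]
    simp only [g, chiSqRatio_eq, hprod, smul_eq_mul]
    rfl
  obtain ⟨c, hc⟩ := (Submodule.mem_span_range_iff_exists_fun ℝ).1 (hle hf)
  classical
  refine ⟨fun κ m => if h : κ ∈ admissible n then c (⟨κ, h⟩, m) else 0, fun x => ?_⟩
  rw [← hc, Finset.sum_apply, Fintype.sum_prod_type, ← Finset.sum_coe_sort (admissible n), Finset.mul_sum]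
  refine Finset.sum_congr rfl fun κ _ => ?_
  rw [cCoef, Finset.sum_mul, Finset.mul_sum]
  refine Finset.sum_congr rfl fun m _ => ?_
  simp only [Pi.smul_apply, smul_eq_mul, g, structVal_eq, Subtype.coe_eta, Finset.coe_mem,
    dif_pos]
  ring

/-- Universal coefficients of the source term exist. -/
theorem exists_isGamma (n : ℕ) (hn : 1 ≤ n) :
    ∃ γ : (Fin (n + 1) → ℕ) → PertStructure n → ℝ, ∀ v : ℕ, IsGamma n v γ := by
  obtain ⟨γ, hγ⟩ := exists_coeff_of_mem_structSpan (relSource_mem n hn)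
  refine ⟨γ, fun v ρ lt hρ hlt lam h0 mu k => ?_⟩
  have h := hγ ⟨v, ρ, lt, hρ, hlt, lam, h0, k⟩
  simp only [relSource] at h
  rw [div_eq_iff hlt.ne'] at h
  have h1 : source n ρ lt lam mu k = mu k + source n ρ lt lam 0 k := by
    simp only [source, orderEq, Pi.zero_apply]
    ring
  have h2 : lt ^ (1 - (n : ℤ)) = (lt ^ n)⁻¹ * lt := by
    rw [zpow_sub₀ hlt.ne', zpow_one, zpow_natCast]
    field_simp
  rw [h1, h, h2]
  ring

/-! ### Recovering a structure from a monomial -/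

section combinatorics

variable {v : ℕ}

/-- The orders occurring in the direction `i`. -/
def fiber (i : Fin v) (D : Multiset (ℕ × Fin v)) : Multiset ℕ :=
  (D.filter fun p => p.2 = i).map Prod.fst

/-- The factors of the aggregates assigned to directions by `P`. -/
def spread (P : Multiset (Multiset ℕ × Fin v)) : Multiset (ℕ × Fin v) :=
  (P.map fun p => p.1.map fun j => (j, p.2)).sum

lemma fiber_add (i : Fin v) (D E : Multiset (ℕ × Fin v)) :
    fiber i (D + E) = fiber i D + fiber i E := by
  simp [fiber]

lemma fiber_map (i i' : Fin v) (t : Multiset ℕ) :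
    fiber i (t.map fun j => (j, i')) = if i' = i then t else 0 := by
  unfold fiber
  rw [Multiset.filter_map, Multiset.map_map]
  split_ifs with h
  · simp [h]
  · simp [h]

lemma fiber_spread (i : Fin v) (P : Multiset (Multiset ℕ × Fin v)) :
    fiber i (spread P) = ((P.filter fun p => p.2 = i).map Prod.fst).sum := by
  induction P using Multiset.induction_on with
  | empty => simp [spread, fiber]
  | cons p P ih =>
    have : spread (p ::ₘ P) = (p.1.map fun j => (j, p.2)) + spread P := by
      simp [spread]
    rw [this, fiber_add, fiber_map, ih, Multiset.filter_cons]
    split_ifs <;> simp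

/-- When the directions are distinct, each aggregate is the whole fiber over its own direction. -/
lemma eq_map_fiber_spread {P : Multiset (Multiset ℕ × Fin v)} (h : (P.map Prod.snd).Nodup) :
    P = (P.map Prod.snd).map fun i => (fiber i (spread P), i) := by
  rw [Multiset.map_map]
  conv_lhs => rw [← Multiset.map_id P]
  refine Multiset.map_congr rfl fun p hp => ?_
  have hf : P.filter (fun q => q.2 = p.2) = {p} := by
    obtain ⟨Q, rfl⟩ := Multiset.exists_cons_of_mem hp
    rw [Multiset.map_cons, Multiset.nodup_cons] at h
    rw [Multiset.filter_cons_of_pos (p := fun q : Multiset ℕ × Fin v => q.2 = p.2) _ rfl,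
      Multiset.filter_eq_nil.2]
    · rfl
    · intro q hq he
      exact h.1 (he ▸ Multiset.mem_map_of_mem Prod.snd hq)
  simp [fiber_spread, hf]

/-- A monomial with aggregates in distinct directions determines the structure among the structures
with at most as many aggregates. -/
lemma eq_of_spread_eq {k : Fin v} {b b' : Multiset ℕ} {P P' : Multiset (Multiset ℕ × Fin v)}
    (hnd : (P.map Prod.snd).Nodup) (hk : k ∉ P.map Prod.snd) (hne : ∀ p ∈ P, p.1 ≠ 0)
    (hcard : P'.card ≤ P.card)
    (h : (b.map fun j => (j, k)) + spread P = (b'.map fun j => (j, k)) + spread P') :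
    b' = b ∧ P' = P := by
  have hfib : ∀ i, i ≠ k → fiber i (spread P) = fiber i (spread P') := by
    intro i hi
    have := congrArg (fiber i) h
    simpa [fiber_add, fiber_map, hi.symm] using this
  -- Every direction used by `P` has a nonempty fiber away from `k`, so `P'` must use it too. The
  -- bound on cardinalities then forces `P'` to use the same directions, once each.
  have hsub : P.map Prod.snd ≤ P'.map Prod.snd := by
    rw [Multiset.le_iff_subset hnd]
    intro i hi
    have hik : i ≠ k := fun e => hk (e ▸ hi)
    obtain ⟨p, hp, rfl⟩ := Multiset.mem_map.1 hi
    have h1 := hfib p.2 hik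
    rw [fiber_spread, fiber_spread] at h1
    by_contra hnot
    have h2 : P'.filter (fun q => q.2 = p.2) = 0 :=
      Multiset.filter_eq_nil.2 fun q hq he => hnot (he ▸ Multiset.mem_map_of_mem Prod.snd hq)
    rw [h2, Multiset.map_zero, Multiset.sum_zero, Multiset.sum_eq_zero_iff] at h1
    exact hne p hp (h1 p.1 (Multiset.mem_map_of_mem _ (Multiset.mem_filter.2 ⟨hp, rfl⟩)))
  have hsnd : P.map Prod.snd = P'.map Prod.snd :=
    Multiset.eq_of_le_of_card_le hsub (by simpa using hcard)
  have hP : P' = P := by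
    refine (eq_map_fiber_spread (hsnd ▸ hnd)).trans (.trans ?_ (eq_map_fiber_spread hnd).symm)
    rw [← hsnd]
    refine Multiset.map_congr rfl fun i hi => ?_
    rw [hfib i fun e => hk (e ▸ hi)]
  refine ⟨?_, hP⟩
  subst hP
  have := congrArg (fiber k) h
  simpa [fiber_add, fiber_map] using this.symm

lemma exists_spread (T : Multiset (Multiset ℕ)) (A : Finset (Fin v)) (h : T.card ≤ A.card) :
    ∃ P : Multiset (Multiset ℕ × Fin v), P.map Prod.fst = T ∧ P.map Prod.snd ≤ A.val := by
  classical
  induction T using Multiset.induction_on generalizing A with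
  | empty => exact ⟨0, by simp, by simp⟩
  | cons t T ih =>
    rw [Multiset.card_cons] at h
    obtain ⟨a, ha⟩ : A.Nonempty := Finset.card_pos.1 (by omega)
    obtain ⟨P, h1, h2⟩ := ih (A.erase a) (by rw [Finset.card_erase_of_mem ha]; omega)
    refine ⟨(t, a) ::ₘ P, by simp [h1], ?_⟩
    have : A.val = a ::ₘ (A.erase a).val := by
      rw [Finset.erase_val, Multiset.cons_erase ha]
    rw [this, Multiset.map_cons]
    exact Multiset.cons_le_cons _ h2

end combinatorics

/-! ### Linear independence of the structures -/

section independence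

variable {v : ℕ}

/-- A product of variables. -/
def prodX (D : Multiset (ℕ × Fin v)) : MvPolynomial (ℕ × Fin v) ℝ := (D.map MvPolynomial.X).prod

lemma prodX_eq (D : Multiset (ℕ × Fin v)) :
    prodX D = MvPolynomial.monomial (Multiset.toFinsupp D) 1 := by
  classical
  induction D using Multiset.induction_on with
  | empty => simp [prodX]
  | cons p D ih =>
    rw [← Multiset.singleton_add, map_add, Multiset.toFinsupp_singleton, ← mul_one (1 : ℝ),
      ← MvPolynomial.monomial_mul, ← ih]
    simp [prodX, MvPolynomial.X]

lemma prodX_add (D E : Multiset (ℕ × Fin v)) : prodX (D + E) = prodX D * prodX E := by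
  simp [prodX]

/-- The polynomial of a structure in the direction `k`. -/
def structPoly (k : Fin v) (b : Multiset ℕ) (T : Multiset (Multiset ℕ)) :
    MvPolynomial (ℕ × Fin v) ℝ :=
  prodX (b.map fun j => (j, k)) * (T.map fun t => ∑ i, prodX (t.map fun j => (j, i))).prod

/-- `Q` lists the assignments of a direction to each aggregate. It is a multiset because repeated
members of `T` can make different choices give the same `P`. -/
lemma exists_expansion (T : Multiset (Multiset ℕ)) :
    ∃ Q : Multiset (Multiset (Multiset ℕ × Fin v)),
      (∀ P, P ∈ Q ↔ P.map Prod.fst = T) ∧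
      (T.map fun t => ∑ i : Fin v, prodX (t.map fun j => (j, i))).prod
        = (Q.map fun P => prodX (spread P)).sum := by
  classical
  induction T using Multiset.induction_on with
  | empty => exact ⟨{0}, by simp, by simp [spread, prodX]⟩
  | cons t T ih =>
    obtain ⟨Q, h1, h2⟩ := ih
    refine ⟨∑ i : Fin v, Q.map fun P => (t, i) ::ₘ P, fun P => ?_, ?_⟩
    · rw [Multiset.mem_sum]
      constructor
      · rintro ⟨i, -, hi⟩
        obtain ⟨P', hP', rfl⟩ := Multiset.mem_map.1 hi
        simp [(h1 P').1 hP']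
      · intro h
        have ht : t ∈ P.map Prod.fst := by rw [h]; exact Multiset.mem_cons_self _ _
        obtain ⟨⟨t', i⟩, hp, rfl⟩ := Multiset.mem_map.1 ht
        obtain ⟨P', rfl⟩ := Multiset.exists_cons_of_mem hp
        refine ⟨i, Finset.mem_univ _, Multiset.mem_map.2 ⟨P', (h1 P').2 ?_, rfl⟩⟩
        simpa using h
    · rw [Multiset.map_cons, Multiset.prod_cons, h2, Finset.sum_mul]
      have : ((∑ i : Fin v, Q.map fun P => (t, i) ::ₘ P).map fun P => prodX (spread P)).sum
          = ∑ i : Fin v, ((Q.map fun P => (t, i) ::ₘ P).map fun P => prodX (spread P)).sum := by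
        rw [← Multiset.coe_mapAddMonoidHom, map_sum, ← Multiset.coe_sumAddMonoidHom, map_sum]
      rw [this]
      refine Finset.sum_congr rfl fun i _ => ?_
      rw [Multiset.map_map, ← Multiset.sum_map_mul_left]
      refine congrArg Multiset.sum (Multiset.map_congr rfl fun P _ => ?_)
      rw [← prodX_add]
      simp [spread]

/-- The coefficient counts assignments, so there is no cancellation in characteristic zero: it is
nonzero exactly when some assignment produces the monomial. -/
lemma coeff_structPoly (k : Fin v) (b : Multiset ℕ) (T : Multiset (Multiset ℕ))
    (D : Multiset (ℕ × Fin v)) :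
    (MvPolynomial.coeff (Multiset.toFinsupp D) (structPoly k b T) ≠ 0 →
      ∃ P, P.map Prod.fst = T ∧ (b.map fun j => (j, k)) + spread P = D) ∧
    ((∃ P, P.map Prod.fst = T ∧ (b.map fun j => (j, k)) + spread P = D) →
      MvPolynomial.coeff (Multiset.toFinsupp D) (structPoly k b T) ≠ 0) := by
  classical
  obtain ⟨Q, h1, h2⟩ := exists_expansion (v := v) T
  have h3 : MvPolynomial.coeff (Multiset.toFinsupp D) (structPoly k b T)
      = ((Q.countP fun P => (b.map fun j => (j, k)) + spread P = D : ℕ) : ℝ) := by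
    rw [structPoly, h2, ← Multiset.sum_map_mul_left]
    clear h1 h2
    induction Q using Multiset.induction_on with
    | empty => simp
    | cons P Q ih =>
      rw [Multiset.map_cons, Multiset.sum_cons, MvPolynomial.coeff_add, ih, ← prodX_add, prodX_eq,
        MvPolynomial.coeff_monomial, Multiset.countP_cons]
      simp only [EmbeddingLike.apply_eq_iff_eq]
      push_cast
      ring
  rw [h3, Nat.cast_ne_zero, ← Nat.pos_iff_ne_zero, Multiset.countP_pos]
  simp only [h1]
  exact ⟨id, id⟩

lemma eval_structPoly (k : Fin v) (b : Multiset ℕ) (T : Multiset (Multiset ℕ))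
    (x : ℕ × Fin v → ℝ) : MvPolynomial.eval x (structPoly k b T) =
      (b.map fun j => x (j, k)).prod * (T.map fun t => ∑ i, (t.map fun j => x (j, i)).prod).prod := by
  simp [structPoly, prodX, map_multiset_prod]

/-- The structures of order `n` are linearly independent in every dimension `v ≥ n + 1`. -/
theorem linearIndependent_val {n : ℕ} (hv : n + 1 ≤ v) (k : Fin v) (c : PertStructure n → ℝ)
    (h : ∀ lam : ℕ → Fin v → ℝ, (∀ i, lam 0 i = 1) → ∑ m, c m * m.val 1 lam k = 0) :
    ∀ m, c m = 0 := by
  classical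
  -- Structures involve only orders at least `1`, so fixing `lam 0 = 1` leaves all relevant
  -- variables free and the vanishing is a polynomial identity.
  have hpoly : ∑ m, MvPolynomial.C (c m) * structPoly k m.b m.T = 0 := by
    refine MvPolynomial.funext fun x => ?_
    rw [map_zero, map_sum, ← h (fun j i => if j = 0 then 1 else x (j, i)) (by simp)]
    refine Finset.sum_congr rfl fun m _ => ?_
    rw [map_mul, MvPolynomial.eval_C, eval_structPoly, PertStructure.val, one_pow, one_mul]
    congr 2
    · refine congrArg Multiset.prod (Multiset.map_congr rfl fun j hj => ?_)
      rw [if_neg (by have := m.b_range j hj; omega)]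
    · refine congrArg Multiset.prod (Multiset.map_congr rfl fun t ht => ?_)
      refine Finset.sum_congr rfl fun i _ => ?_
      refine congrArg Multiset.prod (Multiset.map_congr rfl fun j hj => ?_)
      rw [if_neg (by have := m.T_range t ht j hj; omega)]
  by_contra! hc
  obtain ⟨m₀, hm₀⟩ := hc
  -- Among the structures with nonzero coefficient, one with the most aggregates is chosen, so that
  -- no other can produce its monomial with distinct directions.
  obtain ⟨m, hm, hmax⟩ := Finset.exists_max_image
    (Finset.univ.filter fun m : PertStructure n => c m ≠ 0) (fun m => m.T.card)
    ⟨m₀, by simpa using hm₀⟩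
  replace hm : c m ≠ 0 := by simpa using hm
  have hTcard : m.T.card ≤ n := by
    have h1 : (m.T.map Multiset.card).card ≤ (m.T.map Multiset.card).sum :=
      multiset_card_le_sum _ fun j hj => by
        obtain ⟨t, ht, rfl⟩ := Multiset.mem_map.1 hj
        exact Multiset.card_pos.2 (m.T_ne t ht)
    rw [Multiset.card_map] at h1
    have := m.physDim
    omega
  -- There are at most `n` aggregates, and `v ≥ n + 1` leaves at least `n` directions other than
  -- `k`.
  obtain ⟨P, hP1, hP2⟩ := exists_spread m.T (Finset.univ.erase k) (by
    rw [Finset.card_erase_of_mem (Finset.mem_univ k), Finset.card_univ, Fintype.card_fin]; omega)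
  have hnd : (P.map Prod.snd).Nodup := Multiset.nodup_of_le hP2 (Finset.nodup _)
  have hk : k ∉ P.map Prod.snd := fun hk =>
    Finset.notMem_erase k Finset.univ (Multiset.mem_of_le hP2 hk)
  have hne : ∀ p ∈ P, p.1 ≠ 0 := fun p hp =>
    m.T_ne p.1 (hP1 ▸ Multiset.mem_map_of_mem Prod.fst hp)
  have hcoef := congrArg
    (MvPolynomial.coeff (Multiset.toFinsupp ((m.b.map fun j => (j, k)) + spread P))) hpoly
  rw [MvPolynomial.coeff_sum, Finset.sum_eq_single m, MvPolynomial.coeff_C_mul,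
    MvPolynomial.coeff_zero] at hcoef
  · exact mul_ne_zero hm ((coeff_structPoly k m.b m.T _).2 ⟨P, hP1, rfl⟩) hcoef
  · intro m' _ hm'
    rw [MvPolynomial.coeff_C_mul]
    by_contra hne'
    obtain ⟨hc', hcoef'⟩ := mul_ne_zero_iff.1 hne'
    obtain ⟨P', hP'1, hP'2⟩ := (coeff_structPoly k m'.b m'.T _).1 hcoef'
    have hle := hmax m' (by simpa using hc')
    rw [← hP'1, ← hP1, Multiset.card_map, Multiset.card_map] at hle
    obtain ⟨hb, hPP⟩ := eq_of_spread_eq hnd hk hne hle hP'2.symm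
    exact hm' (PertStructure.ext_of hb (by rw [← hP'1, ← hP1, hPP]))
  · exact fun hm => absurd (Finset.mem_univ m) hm

end independence

/-! ### The limit of infinite radius -/

section limit

variable (n : ℕ)

/-- At `X = 1` the factor `1 - X` kills every perturbation, and the series collapses to `1`. -/
lemma eval_invCoef (d : ℕ) (x : Datum) :
    (invCoef n d x).eval 1 = if d = 0 then 1 else 0 := by
  rw [invCoef_rec]
  simp only [Pi.add_apply, Pi.smul_apply, Finset.sum_apply, Pi.mul_apply, pertCoef_eq]
  split_ifs <;> simp [Polynomial.eval_finsetSum, -ite_smul]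

lemma eval_eulerCoef (d : ℕ) (x : Datum) : (eulerCoef n d x).eval 1 = 0 := by
  simp [eulerCoef_eq, Polynomial.eval_finsetSum, -ite_smul]

lemma eval_rootCoef (d : ℕ) (x : Datum) :
    (rootCoef n d x).eval 1 = if d = 0 then 1 else 0 := by
  rw [rootCoef_rec]
  simp only [Pi.add_apply, Pi.smul_apply, Finset.sum_apply, Pi.mul_apply]
  split_ifs <;> simp [Polynomial.eval_finsetSum, eval_eulerCoef]

lemma eval_numCoef (d : ℕ) (x : Datum) :
    (numCoef n d x).eval 1 = if d = 0 then 1 else 0 := by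
  rw [numCoef_eq]
  simp only [Pi.mul_apply, Finset.sum_apply, Polynomial.eval_mul, Polynomial.eval_X, one_mul,
    Polynomial.eval_finsetSum, eval_rootCoef, eval_invCoef, ite_mul, zero_mul]
  rw [Finset.sum_ite_eq']
  simp

/-- The datum with square radius `N + 1`. -/
def Datum.withRadius (x : Datum) (N : ℕ) : Datum :=
  { x with ρ := N + 1, hρ := by positivity }

open Filter Topology

lemma tendsto_rat (x : Datum) (j : ℕ) : Tendsto (fun N => rat j (x.withRadius N)) atTop (𝓝 1) := by
  have h1 : Tendsto (fun N : ℕ => ((N : ℝ) + 1) / x.lt) atTop atTop :=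
    (tendsto_atTop_add_const_right _ _ tendsto_natCast_atTop_atTop).atTop_div_const x.hlt
  have hv : 0 < x.v := Fin.pos x.k
  have h2 := ((tendsto_chiSqCDF (x.v + 2 * j) (by omega)).comp h1).div
    ((tendsto_chiSqCDF x.v hv).comp h1) one_ne_zero
  rw [div_one] at h2
  exact h2

/-- All ratios tend to `1`, so replacing powers of `X` by ratios becomes evaluation at `X = 1`. -/
lemma tendsto_ellN (x : Datum) (P : Datum → Polynomial ℝ)
    (hP : ∀ N, P (x.withRadius N) = P x) :
    Tendsto (fun N => ellN P (x.withRadius N)) atTop (𝓝 ((P x).eval 1)) := by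
  simp_rw [ellN_eq, hP, Polynomial.eval_eq_sum, one_pow, Polynomial.sum_def]
  exact tendsto_finsetSum _ fun j _ => tendsto_const_nhds.mul (tendsto_rat x j)

lemma tendsto_ratioC (x : Datum) (d : ℕ) :
    Tendsto (fun N => ratioC n d (x.withRadius N)) atTop (𝓝 (if d = 0 then 1 else 0)) := by
  have hA : ∀ a, Tendsto (fun N => alphaCoef n a (x.withRadius N)) atTop
      (𝓝 (if a = 0 then 1 else 0)) := fun a => by
    rw [← eval_rootCoef n a x]
    exact tendsto_ellN x _ fun N => rfl
  induction d using Nat.strong_induction_on with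
  | _ d ih =>
    have hB : Tendsto (fun N => alphaKCoef n d (x.withRadius N)) atTop
        (𝓝 (if d = 0 then 1 else 0)) := by
      rw [← eval_numCoef n d x]
      exact tendsto_ellN x _ fun N => rfl
    have hS : Tendsto (fun N => ∑ a ∈ Finset.range (d + 1), (if a = 0 then 0 else
        alphaCoef n a (x.withRadius N)) * ratioC n (d - a) (x.withRadius N)) atTop
        (𝓝 (∑ a ∈ Finset.range (d + 1), 0)) := by
      refine tendsto_finsetSum _ fun a ha => ?_
      by_cases h0 : a = 0
      · simp [h0]
      · have ha' := Finset.mem_range.1 ha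
        have h1 := hA a
        have h2 := ih (d - a) (by omega)
        have := h1.mul h2
        simp only [if_neg h0, zero_mul] at this ⊢
        exact this
    have := hB.sub hS
    rw [Finset.sum_const_zero, sub_zero] at this
    refine this.congr fun N => ?_
    rw [ratioC_rec]
    simp only [Pi.add_apply, Pi.smul_apply, Finset.sum_apply, Pi.mul_apply, smul_eq_mul]
    rw [neg_one_mul, ← sub_eq_add_neg]
    congr 1
    refine Finset.sum_congr rfl fun a _ => ?_
    split_ifs <;> rfl

/-- The Jacobian tends to the identity and, in the equation of order `n`, only the term `λ^{(n)}
R^{(0)}` survives; the two contributions `λ_k^{(n)}` cancel. -/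
lemma tendsto_source (x : Datum) :
    Tendsto (fun N => source n (x.withRadius N).ρ x.lt x.lam 0 x.k) atTop (𝓝 0) := by
  have hJ : ∀ j, Tendsto (fun N => jac x.v (x.withRadius N).ρ x.lt x.k j * x.lam n j) atTop
      (𝓝 (if x.k = j then x.lam n j else 0)) := by
    intro j
    have h1 := (((tendsto_rat x 2).const_mul (1 + 2 * (if x.k = j then 1 else 0))).sub
      ((tendsto_rat x 1).pow 2)).const_mul (1 / 2) |>.mul_const (x.lam n j)
    refine (h1.congr fun N => ?_).trans (le_of_eq (congrArg _ ?_))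
    · rw [jac, ← div_pow]
      rfl
    · split_ifs <;> ring
  have hE : ∀ j ∈ Finset.range (n + 1), Tendsto (fun N => x.lam (n - j) x.k *
      ratioCoef n (x.withRadius N).ρ x.lam j x.k) atTop
      (𝓝 (x.lam (n - j) x.k * if j = 0 then 1 else 0)) := fun j _ =>
    (tendsto_ratioC n x j).const_mul _
  have h := (tendsto_finsetSum Finset.univ fun j _ => hJ j).sub (tendsto_finsetSum _ hE)
  refine (h.congr fun N => ?_).trans (le_of_eq (congrArg _ ?_))
  · simp [source, orderEq]
  · simp

/-- The coefficients of the source term attached to each structure sum to zero. -/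
theorem sum_coeff_eq_zero {v : ℕ} (hv : n + 1 ≤ v)
    {γ : (Fin (n + 1) → ℕ) → PertStructure n → ℝ} (hγ : IsGamma n v γ) (m : PertStructure n) :
    ∑ κ ∈ admissible n, γ κ m = 0 := by
  let k : Fin v := ⟨0, by omega⟩
  refine linearIndependent_val hv k (fun m => ∑ κ ∈ admissible n, γ κ m) (fun lam h0 => ?_) m
  let x : Datum := ⟨v, 1, 1, one_pos, one_pos, lam, h0, k⟩
  have hR : ∀ κ : Fin (n + 1) → ℕ, Tendsto
      (fun N => chiSqRatio n v κ ((x.withRadius N).ρ / 1)) atTop (𝓝 1) := by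
    intro κ
    have := tendsto_finsetProd Finset.univ fun j (_ : j ∈ Finset.univ) => tendsto_rat x (κ j)
    rw [Finset.prod_const_one] at this
    exact this.congr fun N => (chiSqRatio_eq (x.withRadius N) κ).symm
  have h1 := tendsto_finsetSum (admissible n) fun κ _ =>
    (hR κ).const_mul (cCoef γ 1 lam k κ)
  have h2 := tendsto_nhds_unique (h1.congr fun N => ?_) (tendsto_source n x)
  · simp only [mul_one, cCoef] at h2
    rw [Finset.sum_comm] at h2
    simpa only [Finset.sum_mul] using h2
  · have := hγ (x.withRadius N).ρ 1 (x.withRadius N).hρ one_pos lam h0 0 k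
    simp only [Pi.zero_apply, one_zpow, one_mul, zero_add] at this
    exact this.symm

end limit

end

end TruncatedSpectrum

theorem mainTheorem1 (n : ℕ) (hn : 2 ≤ n) :
    (∃ γ : (Fin (n + 1) → ℕ) → TruncatedSpectrum.PertStructure n → ℝ,
      ∀ v : ℕ, 1 ≤ v → TruncatedSpectrum.IsGamma n v γ) ∧
    (∀ v : ℕ, n + 1 ≤ v →
      ∀ γ : (Fin (n + 1) → ℕ) → TruncatedSpectrum.PertStructure n → ℝ,
        TruncatedSpectrum.IsGamma n v γ →
          ∀ m : TruncatedSpectrum.PertStructure n,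
            ∑ κ ∈ TruncatedSpectrum.admissible n, γ κ m = 0) := by
  obtain ⟨γ, hγ⟩ := TruncatedSpectrum.exists_isGamma n (by omega)
  exact ⟨⟨γ, fun v _ => hγ v⟩, fun v hv γ hγ m =>
    TruncatedSpectrum.sum_coeff_eq_zero n hv hγ m⟩
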